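/- For an integer $n\ge 0$, an $n$-dimensional $\mathfrak{su}(3)$-module is a complex vector space $V$ of dimension $n$ with a homomorphism of real Lie algebras $\mathfrak{su}(3)\to\operatorname{End}_{\mathbb C}(V)$, where $\mathfrak{su}(3)$ is the Lie algebra of traceless skew-Hermitian complex $3\times 3$ matrices; two modules are equivalent if there is a $\mathbb C$-linear isomorphism between them that intertwines the two actions, and a module is irreducible if it is nonzero and has no invariant complex subspaces other than $0$ and itself. Let $\operatorname{Mod}(\mathfrak{su}_3,n)$ be the number of $n$-dimensional $\mathfrak{su}(3)$-modules up to equivalence, let $\xi(n)$ be the number of irreducible $n$-dimensional $\mathfrak{su}(3)$-modules up to equivalence, let $R_3=\{d\in\mathbb N:\xi(d)\neq 0\}$, and let $\mathcal P(R_3,D)$ be the set of partitions of $D$ all of whose parts lie in $R_3$. Write each partition $\mathfrak p$ of $D$ as $D=\sum_{i=1}^{m} n_i p_i$ with distinct parts $p_1,\dots,p_m$ and multiplicities $n_i\ge 1$. Theorem. For every integer $D\ge 0$ and every $n \geq 0$, the numbers $\operatorname{Mod}(\mathfrak{su}_3,D)$ and $\xi(n)$ are finite, and $$\operatorname{Mod}(\mathfrak{su}_3,D)=\sum_{\mathfrak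 p\in\mathcal P(R_3,D)}\ \prod_{i=1}^{m}\binom{n_i+\xi(p_i)-1}{n_i}.$$ -/

import Mathlib

namespace SuThree

attribute [local instance 100] LieRing.ofAssociativeRing

/-- The real Lie algebra `su(3)`: traceless skew-Hermitian complex `3 × 3` matrices with the
commutator bracket. -/
def su3 : LieSubalgebra ℝ (Matrix (Fin 3) (Fin 3) ℂ) where
  carrier := {A | A.conjTranspose = -A ∧ A.trace = 0}
  zero_mem' := by simp
  add_mem' := by
    rintro A B ⟨hA, hA'⟩ ⟨hB, hB'⟩
    refine ⟨?_, ?_⟩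
    · rw [Matrix.conjTranspose_add, hA, hB, neg_add]
    · rw [Matrix.trace_add, hA', hB', add_zero]
  smul_mem' := by
    rintro c A ⟨hA, hA'⟩
    refine ⟨?_, ?_⟩
    · rw [Matrix.conjTranspose_smul, hA, smul_neg, star_trivial]
    · rw [Matrix.trace_smul, hA', smul_zero]
  lie_mem' := by
    rintro A B ⟨hA, -⟩ ⟨hB, -⟩
    refine ⟨?_, ?_⟩
    · rw [Ring.lie_def, Matrix.conjTranspose_sub, Matrix.conjTranspose_mul,
        Matrix.conjTranspose_mul, hA, hB, neg_mul_neg, neg_mul_neg, neg_sub]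
    · rw [Ring.lie_def, Matrix.trace_sub, Matrix.trace_mul_comm, sub_self]

/-- A representation of `su(3)` on the complex vector space `V` (that is, an `su(3)`-module
structure on `V`): a homomorphism of real Lie algebras from `su(3)` to the complex-linear
endomorphisms of `V`. -/
abbrev Rep (V : Type) [AddCommGroup V] [Module ℂ V] : Type :=
  su3 →ₗ⁅ℝ⁆ Module.End ℂ V

/-- Two representations are equivalent if an invertible complex-linear map intertwines them. -/
def Equivalent {V W : Type} [AddCommGroup V] [Module ℂ V] [AddCommGroup W] [Module ℂ W]
    (ρ : Rep V) (σ : Rep W) : Prop :=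
  ∃ e : V ≃ₗ[ℂ] W, ∀ (x : su3) (v : V), e (ρ x v) = σ x (e v)

/-- A representation is irreducible if it is nonzero and its only invariant complex subspaces are
`0` and the whole space. -/
def IsIrreducible {V : Type} [AddCommGroup V] [Module ℂ V] (ρ : Rep V) : Prop :=
  Nontrivial V ∧
    ∀ W : Submodule ℂ V, (∀ (x : su3), ∀ v ∈ W, ρ x v ∈ W) → W = ⊥ ∨ W = ⊤

/-- Equivalence of representations on `ℂⁿ`. Every complex vector space of dimension `n` is
isomorphic to `ℂⁿ`, so every `n`-dimensional representation is equivalent to one on `ℂⁿ`. -/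
def repSetoid (n : ℕ) : Setoid (Rep (Fin n → ℂ)) where
  r := Equivalent
  iseqv :=
    { refl := fun _ => ⟨LinearEquiv.refl ℂ _, fun _ _ => rfl⟩
      symm := by
        rintro ρ σ ⟨e, he⟩
        refine ⟨e.symm, fun x v => ?_⟩
        rw [LinearEquiv.symm_apply_eq, he, LinearEquiv.apply_symm_apply]
      trans := by
        rintro ρ σ τ ⟨e, he⟩ ⟨f, hf⟩
        refine ⟨e.trans f, fun x v => ?_⟩
        rw [LinearEquiv.trans_apply, LinearEquiv.trans_apply, he, hf] }

/-- The equivalence classes of `n`-dimensional `su(3)`-modules. -/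
def ModClass (n : ℕ) : Type := Quotient (repSetoid n)

/-- The equivalence classes of irreducible `n`-dimensional `su(3)`-modules. -/
def irrClass (n : ℕ) : Set (ModClass n) :=
  {c | ∃ ρ : Rep (Fin n → ℂ), IsIrreducible ρ ∧ Quotient.mk (repSetoid n) ρ = c}

/-- `Mod(su(3), n)`: the number of `n`-dimensional `su(3)`-modules up to equivalence. -/
noncomputable def modCount (n : ℕ) : ℕ := Nat.card (ModClass n)

/-- `ξ(n)`: the number of irreducible `n`-dimensional `su(3)`-modules up to equivalence. -/
noncomputable def xi (n : ℕ) : ℕ := (irrClass n).ncard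

/-- `R₃`: the set of dimensions of irreducible `su(3)`-modules. -/
def R3 : Set ℕ := {d | xi d ≠ 0}

open Classical in
/-- `𝒫(H, n)`: the partitions of `n` all of whose parts lie in `H`. -/
noncomputable def partitionsIn (H : Set ℕ) (n : ℕ) : Finset (Nat.Partition n) :=
  Nat.Partition.restricted n (fun k => k ∈ H)

end SuThree

/-! Finite-dimensional modules are completely reducible, and by Schur's lemma the dimension of the
space of intertwiners from an irreducible S to V is the multiplicity of S in V. So classes of
D-dimensional modules correspond to multisets of irreducible classes of total dimension D
(`nonempty_equiv_modClass`). The dimensions of the members form a partition of D; over a part p of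
multiplicity n there remains the choice of an n-element multiset from ξ(p) classes, counted by stars
and bars.

The Lie theory takes place after complexification, for operators `E i j` satisfying the relations of
the matrix units of gl₃ (`Rep.isUnitRep_units`). The trace of the Casimir operator is a positive
multiple of a sum of traces of squares of operators with integer eigenvalues, so a nilpotent Casimir
forces the zero action (`IsUnitRep.eq_zero_of_isNilpotent_casimir`). Splitting off the generalized
kernel of the Casimir therefore yields invariant vectors; applied to a space of maps from V into a
submodule W, this gives an equivariant projection onto W, hence complete reducibility
(`IsUnitRep.exists_isCompl`).

Finiteness of ξ(n) is highest weight theory: an irreducible module is determined by its highest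
weight (`exists_linearEquiv_of_isHighestWeight`), and a weight is determined by two natural numbers,
both smaller than n. -/

namespace SuThree

open Module LinearMap

/-! ### Integrality of weights for sl₂ -/

section Sl2

attribute [local instance] LieRing.ofAssociativeRing

variable {V : Type} [AddCommGroup V] [Module ℂ V] [FiniteDimensional ℂ V]

/-- In a finite-dimensional representation of `sl₂`, a highest weight is a natural number smaller
than the dimension. -/
theorem sl2_highest_weight {H X Y : End ℂ V} (hXY : X * Y - Y * X = H)
    (hHX : H * X - X * H = 2 • X) (hHY : H * Y - Y * H = -(2 • Y)) {μ : ℂ} {v : V} (hv : v ≠ 0)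
    (hHv : H v = μ • v) (hXv : X v = 0) : ∃ n : ℕ, μ = n ∧ n < finrank ℂ V := by
  -- `IsSl2Triple` demands H ≠ 0; for H = 0 the weight is 0.
  by_cases hH : H = 0
  · refine ⟨0, ?_, finrank_pos_iff_exists_ne_zero.mpr ⟨v, hv⟩⟩
    simpa [hH, hv, eq_comm] using hHv
  have t : IsSl2Triple H X Y := ⟨hH, hXY, hHX, hHY⟩
  have P : t.HasPrimitiveVectorWith v μ := ⟨hv, hHv, hXv⟩
  obtain ⟨n, hn⟩ := P.exists_nat
  refine ⟨n, hn, ?_⟩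
  -- The vectors Y^i v with 0 ≤ i ≤ n are nonzero with distinct eigenvalues μ - 2i, so V contains n
  -- + 1 independent vectors.
  have hinj : Function.Injective fun i : Fin (n + 1) => μ - 2 * ((i : ℕ) : ℂ) := by
    intro i j hij
    simpa [Fin.ext_iff] using hij
  have hli := Module.End.eigenvectors_linearIndependent' H
    (fun i : Fin (n + 1) => μ - 2 * ((i : ℕ) : ℂ)) hinj
    (fun i => ((LieModule.toEnd ℂ (End ℂ V) V Y) ^ (i : ℕ)) v)
    (fun i => End.hasEigenvector_iff.mpr ⟨End.mem_eigenspace_iff.mpr (P.lie_h_pow_toEnd_f i),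
      P.pow_toEnd_f_ne_zero_of_eq_nat hn (Nat.lt_succ_iff.mp i.2)⟩)
  simpa using hli.fintype_card_le_finrank

/-- In a finite-dimensional representation of `sl₂`, the eigenvalues of `h` are integers. -/
theorem sl2_eigenvalue_int {H X Y : End ℂ V} (hXY : X * Y - Y * X = H)
    (hHX : H * X - X * H = 2 • X) (hHY : H * Y - Y * H = -(2 • Y)) {μ : ℂ}
    (hμ : H.HasEigenvalue μ) : ∃ n : ℤ, μ = n := by
  obtain ⟨v, hv⟩ := hμ.exists_hasEigenvector
  -- X raises eigenvalues by 2, so some power of X kills v; the last nonzero X^k v is a highest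
  -- weight vector, whose weight μ + 2k is a natural number.
  have key : ∀ k : ℕ, H ((X ^ k) v) = (μ + 2 * k) • (X ^ k) v := by
    intro k
    induction k with
    | zero => simpa using hv.apply_eq_smul
    | succ k ih =>
      have h := congrArg (fun f : End ℂ V => f ((X ^ k) v)) hHX
      simp only [LinearMap.sub_apply, End.mul_apply, ih, map_smul, LinearMap.smul_apply] at h
      rw [pow_succ', End.mul_apply, sub_eq_iff_eq_add.mp h, two_nsmul]
      push_cast
      module
  have hz : ∃ k, (X ^ k) v = 0 := by
    by_contra! hne
    have hinj : Function.Injective fun k : ℕ => μ + 2 * (k : ℂ) := by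
      intro i j hij
      simpa using hij
    have hli := End.eigenvectors_linearIndependent' H _ hinj (fun k => (X ^ k) v)
      (fun k => End.hasEigenvector_iff.mpr ⟨End.mem_eigenspace_iff.mpr (key k), hne k⟩)
    exact not_finite_iff_infinite.mpr inferInstance hli.finite
  obtain ⟨k, hk, hk'⟩ := Nat.exists_not_and_succ_of_not_zero_of_exists
    (p := fun k => (X ^ k) v = 0) (by simpa using hv.2) hz
  obtain ⟨n, hn, -⟩ := sl2_highest_weight hXY hHX hHY hk (key k)
    (by rwa [pow_succ', End.mul_apply] at hk')
  exact ⟨n - 2 * k, by push_cast; rw [← hn]; ring⟩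

end Sl2

/-! ### Traces of squares and nilpotency -/

section Trace

variable {V : Type} [AddCommGroup V] [Module ℂ V]

/-- Cyclicity of the trace: tr(H²) = tr((XY - YX)H) = tr(X(YH - HY)) = 2 tr(XY). -/
theorem sl2_trace {H X Y : End ℂ V} (hXY : X * Y - Y * X = H)
    (hHY : H * Y - Y * H = -(2 • Y)) : trace ℂ V (X * Y) = trace ℂ V (H * H) / 2 := by
  have h1 : trace ℂ V (H * H) = trace ℂ V (X * (Y * H - H * Y)) := by
    nth_rewrite 1 [← hXY]
    rw [sub_mul, mul_sub, map_sub, map_sub, mul_assoc, mul_assoc, LinearMap.trace_mul_comm ℂ Y,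
      mul_assoc]
  have h2 : Y * H - H * Y = (2 : ℂ) • Y := by
    rw [← neg_sub, hHY, neg_neg, ofNat_smul_eq_nsmul ℂ]
  rw [h1, h2, mul_smul_comm, map_smul, smul_eq_mul]
  ring

theorem hasEigenvalue_iff_maxGenEigenspace_ne_bot (H : End ℂ V) (μ : ℂ) :
    H.HasEigenvalue μ ↔ H.maxGenEigenspace μ ≠ ⊥ := by
  refine ⟨fun h h' => h (eq_bot_iff.mpr (End.eigenspace_le_maxGenEigenspace.trans h'.le)),
    fun h => ?_⟩
  have h1 : H.HasUnifEigenvalue μ ⊤ := h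
  exact h1.lt zero_lt_one

/-- The relation reads HX = X(H + 2), hence H^n X = X(H + 2)^n. The left side vanishes for large n,
while H + 2 is a unit plus a commuting nilpotent, so invertible. -/
theorem eq_zero_of_isNilpotent_of_commutator_eq_smul {H X : End ℂ V} (hH : IsNilpotent H)
    (h : H * X - X * H = 2 • X) : X = 0 := by
  obtain ⟨n, hn⟩ := hH
  have h1 : ∀ k, H ^ k * X = X * (H + 2) ^ k := by
    intro k
    induction k with
    | zero => simp
    | succ k ih =>
      have h2 : H * X = X * (H + 2) := by
        rw [sub_eq_iff_eq_add.mp h, mul_add, mul_two, two_nsmul]; abel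
      rw [pow_succ, mul_assoc, h2, ← mul_assoc, ih, mul_assoc, ← pow_succ]
  have h3 : IsUnit (H + 2) := by
    have : IsUnit (2 : End ℂ V) := by
      have := (IsUnit.mk0 (2 : ℂ) two_ne_zero).map (algebraMap ℂ (End ℂ V))
      rwa [map_ofNat] at this
    exact IsNilpotent.isUnit_add_right_of_commute ⟨n, hn⟩ this (Commute.ofNat_right H 2)
  have h4 := h1 n
  rw [hn, zero_mul] at h4
  exact (h3.pow n).mul_left_eq_zero.mp h4.symm

variable [FiniteDimensional ℂ V]

/-- H - μ is nilpotent on the generalized eigenspace of μ, so H² has trace μ² times the dimension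
there. Working with generalized eigenspaces avoids having to know that H is diagonalizable. -/
theorem trace_mul_self_eq_sum (H : End ℂ V) :
    ∃ s : Finset ℂ, (∀ μ, μ ∈ s ↔ H.HasEigenvalue μ) ∧
      trace ℂ V (H * H) = ∑ μ ∈ s, μ ^ 2 * finrank ℂ (H.maxGenEigenspace μ) := by
  have hint : DirectSum.IsInternal H.maxGenEigenspace :=
    DirectSum.isInternal_submodule_of_iSupIndep_of_iSup_eq_top H.independent_maxGenEigenspace
      H.iSup_maxGenEigenspace_eq_top
  have hfin : {μ | H.maxGenEigenspace μ ≠ ⊥}.Finite :=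
    WellFoundedGT.finite_ne_bot_of_iSupIndep H.independent_maxGenEigenspace
  refine ⟨hfin.toFinset, fun μ => by simp [hasEigenvalue_iff_maxGenEigenspace_ne_bot], ?_⟩
  have hm := fun μ => End.mapsTo_maxGenEigenspace_of_comm (Commute.refl H) μ
  have hm2 := fun μ => End.mapsTo_maxGenEigenspace_of_comm
    (show Commute H (H * H) from (Commute.refl H).mul_right (Commute.refl H)) μ
  rw [trace_eq_sum_trace_restrict' hint hfin hm2]
  refine Finset.sum_congr rfl fun μ _ => ?_
  have hnil : IsNilpotent (H.restrict (hm μ) - algebraMap ℂ (End ℂ (H.maxGenEigenspace μ)) μ) :=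
    H.isNilpotent_restrict_maxGenEigenspace_sub_algebraMap μ
  have h1 : (H * H).restrict (hm2 μ) = H.restrict (hm μ) ∘ₗ H.restrict (hm μ) := rfl
  have h2 := trace_comp_eq_mul_of_commute_of_isNilpotent μ (Commute.one_left _) hnil
  rw [trace_one] at h2
  rw [h1, trace_comp_eq_mul_of_commute_of_isNilpotent μ (Commute.refl _) hnil, sq, mul_assoc, ← h2]
  rfl

theorem trace_mul_self_re_nonneg {H : End ℂ V} (hH : ∀ μ, H.HasEigenvalue μ → ∃ n : ℤ, μ = n) :
    0 ≤ (trace ℂ V (H * H)).re := by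
  obtain ⟨s, hs, ht⟩ := trace_mul_self_eq_sum H
  rw [ht, Complex.re_sum]
  refine Finset.sum_nonneg fun μ hμ => ?_
  obtain ⟨n, rfl⟩ := hH μ ((hs μ).mp hμ)
  norm_cast
  positivity

theorem isNilpotent_of_hasEigenvalue_eq_zero {H : End ℂ V} (hH : ∀ μ, H.HasEigenvalue μ → μ = 0) :
    IsNilpotent H := by
  have h1 : H.maxGenEigenspace 0 = ⊤ := by
    rw [eq_top_iff, ← H.iSup_maxGenEigenspace_eq_top]
    refine iSup_le fun μ => ?_
    by_cases h : H.maxGenEigenspace μ = ⊥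
    · simp [h]
    · rw [hH μ ((hasEigenvalue_iff_maxGenEigenspace_ne_bot H μ).mpr h)]
  refine ⟨finrank ℂ V, LinearMap.ext fun v => ?_⟩
  have h2 : v ∈ H.maxGenEigenspace 0 := h1 ▸ Submodule.mem_top
  rw [End.maxGenEigenspace_eq_genEigenspace_finrank, End.mem_genEigenspace_nat] at h2
  simpa using h2

/-- With integer eigenvalues the trace is a sum of nonnegative terms, each of which must vanish; the
multiplicities are positive, so 0 is the only eigenvalue. -/
theorem isNilpotent_of_trace_mul_self_re {H : End ℂ V}
    (hH : ∀ μ, H.HasEigenvalue μ → ∃ n : ℤ, μ = n) (h0 : (trace ℂ V (H * H)).re = 0) :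
    IsNilpotent H := by
  obtain ⟨s, hs, ht⟩ := trace_mul_self_eq_sum H
  refine isNilpotent_of_hasEigenvalue_eq_zero fun μ hμ => ?_
  rw [ht, Complex.re_sum, Finset.sum_eq_zero_iff_of_nonneg] at h0
  · have h1 := h0 μ ((hs μ).mpr hμ)
    obtain ⟨n, rfl⟩ := hH μ hμ
    norm_cast at h1
    rcases mul_eq_zero.mp h1 with h | h
    · simpa using h
    · have h2 := Submodule.finrank_eq_zero.mp (Nat.cast_eq_zero.mp h)
      exact absurd h2 ((hasEigenvalue_iff_maxGenEigenspace_ne_bot H _).mp hμ)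
  · intro μ hμ
    obtain ⟨n, rfl⟩ := hH μ ((hs μ).mp hμ)
    norm_cast
    positivity

end Trace

/-! ### Matrix-unit operators and the Casimir -/

/-- A representation of `gl₃` on `V` in which the identity matrix acts by zero, given by the
operators `E i j` of the matrix units. -/
structure IsUnitRep {V : Type} [AddCommGroup V] [Module ℂ V]
    (E : Fin 3 → Fin 3 → End ℂ V) : Prop where
  comm : ∀ i j k l, E i j * E k l - E k l * E i j =
    (if j = k then E i l else 0) - (if l = i then E k j else 0)
  sum_diag : ∑ i, E i i = 0

/-- The subspace `W` is invariant under all the operators `E i j`. -/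
def IsInvariant {V : Type} [AddCommGroup V] [Module ℂ V]
    (E : Fin 3 → Fin 3 → End ℂ V) (W : Submodule ℂ V) : Prop :=
  ∀ i j, ∀ v ∈ W, E i j v ∈ W

/-- The Casimir operator. -/
noncomputable def casimir {V : Type} [AddCommGroup V] [Module ℂ V]
    (E : Fin 3 → Fin 3 → End ℂ V) : End ℂ V :=
  ∑ i, ∑ j, E i j * E j i

section

variable {V : Type} [AddCommGroup V] [Module ℂ V] {E : Fin 3 → Fin 3 → End ℂ V}

theorem IsUnitRep.restrict (hE : IsUnitRep E) {W : Submodule ℂ V} (hW : IsInvariant E W) :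
    IsUnitRep fun i j => (E i j).restrict (hW i j) where
  comm i j k l := by
    ext v
    have h := congrArg (fun f : End ℂ V => f v) (hE.comm i j k l)
    split_ifs at h ⊢ <;> simpa using h
  sum_diag := by
    ext v
    have h := congrArg (fun f : End ℂ V => f v) hE.sum_diag
    simpa using h

theorem casimir_restrict {W : Submodule ℂ V} (hW : IsInvariant E W) (v : W) :
    (casimir (fun i j => (E i j).restrict (hW i j)) v : V) = casimir E v := by
  simp [casimir]

/-- The adjoint action on endomorphisms. -/
theorem IsUnitRep.adjoint (hE : IsUnitRep E) :
    IsUnitRep fun i j => LinearMap.mulLeft ℂ (E i j) - LinearMap.mulRight ℂ (E i j) where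
  comm i j k l := by
    have h := hE.comm i j k l
    refine LinearMap.ext fun f => ?_
    have : ∀ p : Prop, [Decidable p] → ∀ X : End ℂ V,
        (if p then mulLeft ℂ X - mulRight ℂ X else 0) f =
        (if p then X else 0) * f - f * (if p then X else 0) := by
      intro p _ X
      split_ifs <;> simp
    rw [LinearMap.sub_apply, LinearMap.sub_apply, this, this]
    simp only [End.mul_apply, LinearMap.sub_apply, mulLeft_apply, mulRight_apply]
    have e : ∀ A B : End ℂ V, A * f - f * A - (B * f - f * B) = (A - B) * f - f * (A - B) := by
      intros; noncomm_ring
    rw [e, ← h]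
    noncomm_ring
  sum_diag := by
    refine LinearMap.ext fun f => ?_
    have h := hE.sum_diag
    simp only [LinearMap.sum_apply, LinearMap.sub_apply, mulLeft_apply, mulRight_apply,
      Finset.sum_sub_distrib, ← Finset.sum_mul, ← Finset.mul_sum, h]
    simp

/-- The derivation rule expands each commutator into four terms; after summation over i and j the
first cancels the fourth and the second cancels the third. -/
theorem IsUnitRep.commute_casimir (hE : IsUnitRep E) (k l : Fin 3) :
    Commute (E k l) (casimir E) := by
  have h : ∀ i j, E k l * (E i j * E j i) - E i j * E j i * E k l =
      ((if l = i then E k j * E j i else 0) - (if j = k then E i l * E j i else 0)) +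
      ((if l = j then E i j * E k i else 0) - (if i = k then E i j * E j l else 0)) := by
    intro i j
    have e1 := hE.comm k l i j
    have e2 := hE.comm k l j i
    calc _ = (E k l * E i j - E i j * E k l) * E j i + E i j * (E k l * E j i - E j i * E k l) := by
            noncomm_ring
      _ = _ := by
        rw [e1, e2, sub_mul, mul_sub]
        simp only [ite_mul, mul_ite, zero_mul, mul_zero]
  rw [Commute, SemiconjBy, ← sub_eq_zero, casimir, Finset.mul_sum, Finset.sum_mul,
    ← Finset.sum_sub_distrib]
  simp_rw [Finset.mul_sum, Finset.sum_mul, ← Finset.sum_sub_distrib, h, Finset.sum_add_distrib,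
    Finset.sum_sub_distrib]
  rw [Finset.sum_comm (f := fun i j => if l = i then E k j * E j i else 0)]
  simp

/-! ### The trace of the Casimir and complete reducibility -/

section sl2

theorem IsUnitRep.sl2_rel (hE : IsUnitRep E) {i j : Fin 3} (hij : i ≠ j) :
    E i j * E j i - E j i * E i j = E i i - E j j ∧
    (E i i - E j j) * E i j - E i j * (E i i - E j j) = 2 • E i j ∧
    (E i i - E j j) * E j i - E j i * (E i i - E j j) = -(2 • E j i) := by
  refine ⟨by simpa using hE.comm i j j i, ?_, ?_⟩
  · have h1 := hE.comm i i i j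
    have h2 := hE.comm j j i j
    simp only [hij.symm, if_true, if_false] at h1 h2
    calc _ = (E i i * E i j - E i j * E i i) - (E j j * E i j - E i j * E j j) := by noncomm_ring
      _ = _ := by rw [h1, h2]; abel
  · have h1 := hE.comm i i j i
    have h2 := hE.comm j j j i
    simp only [hij, if_true, if_false] at h1 h2
    calc _ = (E i i * E j i - E j i * E i i) - (E j j * E j i - E j i * E j j) := by noncomm_ring
      _ = _ := by rw [h1, h2]; abel

/-- Let S be the sum of the three traces. The off-diagonal products contribute S by `sl2_trace`. The
diagonal squares contribute S/3, because the diagonal operators sum to zero. -/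
theorem IsUnitRep.trace_casimir (hE : IsUnitRep E) :
    trace ℂ V (casimir E) = 4 / 3 * (trace ℂ V ((E 0 0 - E 1 1) * (E 0 0 - E 1 1)) +
      trace ℂ V ((E 1 1 - E 2 2) * (E 1 1 - E 2 2)) +
      trace ℂ V ((E 0 0 - E 2 2) * (E 0 0 - E 2 2))) := by
  have h : ∀ {i j : Fin 3}, i ≠ j →
      trace ℂ V (E i j * E j i) = trace ℂ V ((E i i - E j j) * (E i i - E j j)) / 2 :=
    fun hij => sl2_trace (hE.sl2_rel hij).1 (hE.sl2_rel hij).2.2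
  have h2 : E 2 2 = - (E 0 0 + E 1 1) := by
    have := hE.sum_diag
    rw [Fin.sum_univ_three] at this
    exact eq_neg_of_add_eq_zero_right this
  have hc : trace ℂ V (E 1 1 * E 0 0) = trace ℂ V (E 0 0 * E 1 1) := LinearMap.trace_mul_comm ..
  simp only [casimir, Fin.sum_univ_three, map_add]
  rw [h (i := 0) (j := 1) (by decide), h (i := 0) (j := 2) (by decide),
    h (i := 1) (j := 0) (by decide), h (i := 1) (j := 2) (by decide),
    h (i := 2) (j := 0) (by decide), h (i := 2) (j := 1) (by decide), h2]
  simp only [mul_sub, sub_mul, mul_add, add_mul, mul_neg, neg_mul, map_sub, map_add, map_neg, hc]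
  ring

variable [FiniteDimensional ℂ V]

theorem IsUnitRep.eigenvalue_int (hE : IsUnitRep E) {i j : Fin 3} (hij : i ≠ j) (μ : ℂ)
    (hμ : (E i i - E j j).HasEigenvalue μ) : ∃ n : ℤ, μ = n :=
  sl2_eigenvalue_int (hE.sl2_rel hij).1 (hE.sl2_rel hij).2.1 (hE.sl2_rel hij).2.2 hμ

/-- The trace of a nilpotent Casimir is 0, so each of its three nonnegative contributions is 0 and
all `E i i - E j j` are nilpotent. The sl₂ relations then kill the off-diagonal operators, which
makes the diagonal ones equal; their sum is zero. -/
theorem IsUnitRep.eq_zero_of_isNilpotent_casimir (hE : IsUnitRep E)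
    (hC : IsNilpotent (casimir E)) (i j : Fin 3) : E i j = 0 := by
  have h0 : trace ℂ V (casimir E) = 0 := (isNilpotent_trace_of_isNilpotent hC).eq_zero
  rw [hE.trace_casimir] at h0
  have p := fun {i j : Fin 3} (hij : i ≠ j) => trace_mul_self_re_nonneg (hE.eigenvalue_int hij)
  have p1 := p (i := 0) (j := 1) (by decide)
  have p2 := p (i := 1) (j := 2) (by decide)
  have p3 := p (i := 0) (j := 2) (by decide)
  have h0' := congrArg Complex.re ((mul_eq_zero.mp h0).resolve_left (by norm_num))
  simp only [Complex.add_re, Complex.zero_re] at h0'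
  have n := fun {i j : Fin 3} (hij : i ≠ j) =>
    isNilpotent_of_trace_mul_self_re (hE.eigenvalue_int hij)
  have n1 := n (i := 0) (j := 1) (by decide) (by linarith)
  have n2 := n (i := 1) (j := 2) (by decide) (by linarith)
  have n3 := n (i := 0) (j := 2) (by decide) (by linarith)
  have hnil : ∀ i j, i ≠ j → IsNilpotent (E i i - E j j) := by
    intro i j hij
    have hs : ∀ {k l}, IsNilpotent (E k k - E l l) → IsNilpotent (E l l - E k k) := by
      intro k l h
      rw [← neg_sub]
      exact h.neg
    fin_cases i <;> fin_cases j <;> first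
      | exact absurd rfl hij
      | assumption
      | exact hs n1
      | exact hs n2
      | exact hs n3
  have hoff : ∀ i j, i ≠ j → E i j = 0 := fun i j hij =>
    eq_zero_of_isNilpotent_of_commutator_eq_smul (hnil i j hij) (hE.sl2_rel hij).2.1
  have hdiag : ∀ i j, E i i = E j j := by
    intro i j
    by_cases hij : i = j
    · rw [hij]
    · have := (hE.sl2_rel hij).1
      rw [hoff i j hij, zero_mul, mul_zero, sub_zero] at this
      exact (sub_eq_zero.mp this.symm)
  by_cases hij : i = j
  · subst hij
    have := hE.sum_diag
    rw [Finset.sum_congr rfl fun k _ => hdiag k i, Finset.sum_const, Finset.card_univ,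
      Fintype.card_fin, ← ofNat_smul_eq_nsmul ℂ] at this
    simpa using this
  · exact hoff i j hij

/-- If the image of the action lies in a proper subspace, then there is an invariant vector outside
that subspace. -/
theorem IsUnitRep.exists_invariant_notMem (hE : IsUnitRep E) {N : Submodule ℂ V} (hN : N ≠ ⊤)
    (hEN : ∀ i j v, E i j v ∈ N) : ∃ v ∉ N, ∀ i j, E i j v = 0 := by
  set C := casimir E with hC
  set K : Submodule ℂ V := C.maxGenEigenspace 0 with hK
  have hKinv : IsInvariant E K := fun i j =>
    End.mapsTo_maxGenEigenspace_of_comm (hE.commute_casimir i j).symm 0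
  have hCN : ∀ v, C v ∈ N := by
    intro v
    simp only [hC, casimir, LinearMap.sum_apply, End.mul_apply]
    exact sum_mem fun i _ => sum_mem fun j _ => hEN i j _
  -- On the generalized kernel K the Casimir is nilpotent, so the whole action vanishes there.
  have hKzero : ∀ v ∈ K, ∀ i j, E i j v = 0 := by
    intro v hv i j
    have hnil : IsNilpotent (casimir fun i j => (E i j).restrict (hKinv i j)) := by
      refine ⟨finrank ℂ V, LinearMap.ext fun w => Subtype.ext ?_⟩
      have h1 : ∀ (m : ℕ) (w : K), (((casimir fun i j => (E i j).restrict (hKinv i j)) ^ m) w : V) =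
          (C ^ m) w := by
        intro m
        induction m with
        | zero => simp
        | succ m ih =>
          intro w
          rw [pow_succ, pow_succ, End.mul_apply, End.mul_apply, ih, casimir_restrict]
      have h2 : (w : V) ∈ C.maxGenEigenspace 0 := w.2
      rw [End.maxGenEigenspace_eq_genEigenspace_finrank, End.mem_genEigenspace_nat] at h2
      rw [h1]
      simpa using h2
    have := (hE.restrict hKinv).eq_zero_of_isNilpotent_casimir hnil i j
    simpa using congrArg (fun f : End ℂ K => (f ⟨v, hv⟩ : V)) this
  -- Fitting decomposition: V is K plus the eventual range of C, and the range of C lies in N.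
  have hcodis : K ⊔ N = ⊤ := by
    have h1 := C.isCompl_iSup_ker_pow_iInf_range_pow.sup_eq_top
    rw [eq_top_iff, ← h1]
    refine sup_le_sup (iSup_le fun m v hv => ?_) (iInf_le_of_le 1 ?_)
    · rw [hK, End.mem_maxGenEigenspace]
      exact ⟨m, by simpa using hv⟩
    · rintro _ ⟨v, rfl⟩
      simpa using hCN v
  have hKN : ¬ K ≤ N := fun h => hN (by rwa [sup_eq_right.mpr h] at hcodis)
  obtain ⟨v, hv, hvN⟩ := SetLike.not_le_iff_exists.mp hKN
  exact ⟨v, hvN, hKzero v hv⟩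

/-- Complete reducibility. -/
theorem IsUnitRep.exists_isCompl (hE : IsUnitRep E) {W : Submodule ℂ V} (hW : IsInvariant E W) :
    ∃ W', IsInvariant E W' ∧ IsCompl W W' := by
  by_cases hbot : W = ⊥
  · subst hbot
    exact ⟨⊤, fun _ _ _ _ => Submodule.mem_top, isCompl_bot_top⟩
  obtain ⟨w₀, hw₀, hw₀'⟩ := W.exists_mem_ne_zero_of_ne_bot hbot
  -- M consists of the maps into W that are scalar on W, and N below of those that vanish on W. The
  -- adjoint action sends M into N, so an invariant element of M outside N is a nonzero multiple of
  -- an equivariant projection onto W.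
  let M : Submodule ℂ (End ℂ V) :=
    { carrier := {f | (∀ v, f v ∈ W) ∧ ∃ c : ℂ, ∀ w ∈ W, f w = c • w}
      zero_mem' := ⟨fun v => by simp, 0, fun w _ => by simp⟩
      add_mem' := by
        rintro f g ⟨hf, c, hc⟩ ⟨hg, d, hd⟩
        exact ⟨fun v => add_mem (hf v) (hg v), c + d, fun w hw => by
          rw [LinearMap.add_apply, hc w hw, hd w hw, add_smul]⟩
      smul_mem' := by
        rintro a f ⟨hf, c, hc⟩
        exact ⟨fun v => W.smul_mem a (hf v), a * c, fun w hw => by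
          rw [LinearMap.smul_apply, hc w hw, mul_smul]⟩ }
  have hkill : ∀ i j, ∀ f ∈ M, ∀ w ∈ W, (E i j * f - f * E i j) w = 0 := by
    rintro i j f ⟨-, c, hc⟩ w hw
    simp [End.mul_apply, hc w hw, hc _ (hW i j w hw)]
  have hMinv : IsInvariant
      (fun i j => LinearMap.mulLeft ℂ (E i j) - LinearMap.mulRight ℂ (E i j)) M := by
    rintro i j f hf
    refine ⟨fun v => sub_mem (hW i j _ (hf.1 v)) (hf.1 _), 0, fun w hw => ?_⟩
    rw [zero_smul]
    exact hkill i j f hf w hw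
  let N : Submodule ℂ M :=
    { carrier := {f | ∀ w ∈ W, (f : End ℂ V) w = 0}
      zero_mem' := fun w _ => by simp
      add_mem' := fun {f g} hf hg w hw => by simp [hf w hw, hg w hw]
      smul_mem' := fun a f hf w hw => by simp [hf w hw] }
  -- Any linear projection onto W lies in M but not in N, since W is nonzero.
  have hN : N ≠ ⊤ := by
    obtain ⟨p, hp⟩ := W.subtype.exists_leftInverse_of_injective W.ker_subtype
    have hpw : ∀ w ∈ W, (W.subtype ∘ₗ p) w = w := fun w hw =>
      congrArg Subtype.val (congrArg (fun f : W →ₗ[ℂ] W => f ⟨w, hw⟩) hp)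
    intro htop
    have hpM : W.subtype ∘ₗ p ∈ M :=
      ⟨fun v => (p v).2, 1, fun w hw => by rw [hpw w hw, one_smul]⟩
    have hpN : (⟨_, hpM⟩ : M) ∈ N := htop ▸ Submodule.mem_top
    exact hw₀' ((hpw w₀ hw₀).symm.trans (hpN w₀ hw₀))
  obtain ⟨⟨f, hf⟩, hfN, hfE⟩ := (hE.adjoint.restrict hMinv).exists_invariant_notMem hN (by
    rintro i j ⟨f, hf⟩
    exact hkill i j f hf)
  obtain ⟨hfW, c, hc⟩ := hf
  have hc0 : c ≠ 0 := by
    rintro rfl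
    exact hfN fun w hw => by simpa using hc w hw
  have hcomm : ∀ i j v, E i j (f v) = f (E i j v) := by
    intro i j v
    have := congrArg (fun g : M => (g : End ℂ V) v) (hfE i j)
    exact sub_eq_zero.mp (by simpa using this)
  refine ⟨LinearMap.ker f, fun i j v hv => ?_, ?_, ?_⟩
  · rw [LinearMap.mem_ker] at hv ⊢
    rw [← hcomm, hv, map_zero]
  · rw [Submodule.disjoint_def]
    intro w hw hw'
    rw [LinearMap.mem_ker, hc w hw, smul_eq_zero] at hw'
    exact hw'.resolve_left hc0
  · rw [codisjoint_iff, eq_top_iff]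
    intro v _
    refine Submodule.mem_sup.mpr ⟨c⁻¹ • f v, W.smul_mem _ (hfW v), v - c⁻¹ • f v, ?_, by abel⟩
    rw [LinearMap.mem_ker, map_sub, map_smul, hc _ (hfW v), inv_smul_smul₀ hc0, sub_self]

end sl2

end


/-! ### Highest weight theory -/

section

variable {V W : Type} [AddCommGroup V] [Module ℂ V] [AddCommGroup W] [Module ℂ W]
  {E : Fin 3 → Fin 3 → End ℂ V} {F : Fin 3 → Fin 3 → End ℂ W}

theorem IsUnitRep.apply_apply (hE : IsUnitRep E) (i j k l : Fin 3) (v : V) :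
    E i j (E k l v) = E k l (E i j v) + ((if j = k then E i l v else 0) -
      (if l = i then E k j v else 0)) := by
  have h := congrArg (fun f : End ℂ V => f v) (hE.comm i j k l)
  have e : ∀ (p : Prop) [Decidable p] (X : End ℂ V),
      (if p then X else 0) v = if p then X v else 0 := by
    intro p _ X
    split_ifs <;> rfl
  simp only [LinearMap.sub_apply, End.mul_apply, e] at h
  rw [← h]
  abel

/-- `v` is a highest weight vector, with weight given by the eigenvalues of the diagonal units. -/
structure IsHighestWeight (E : Fin 3 → Fin 3 → End ℂ V) (χ : Fin 3 → ℂ) (v : V) : Prop where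
  ne_zero : v ≠ 0
  diag : ∀ i, E i i v = χ i • v
  raise : ∀ i j, i < j → E i j v = 0

/-- Take an eigenvalue of `E 0 0 - E 2 2` with maximal real part. Raising operators increase the
eigenvalue by 1 or 2, so they kill its eigenspace. `E 1 1` preserves this eigenspace, and an
eigenvector of it there is one for all three diagonal operators because they sum to zero. -/
theorem IsUnitRep.exists_isHighestWeight (hE : IsUnitRep E) [FiniteDimensional ℂ V] [Nontrivial V] :
    ∃ χ v, IsHighestWeight E χ v := by
  set H := E 0 0 - E 2 2 with hH
  have hfin : {μ | H.HasEigenvalue μ}.Finite := H.finite_hasEigenvalue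
  obtain ⟨z, hz, hmax⟩ := Set.exists_max_image _ Complex.re hfin (End.exists_eigenvalue H)
  set K := H.eigenspace z with hK
  have hnot : ∀ c : ℂ, 0 < c.re → ∀ v, H v = (z + c) • v → v = 0 := by
    intro c hc v hv
    by_contra hv0
    have := hmax (z + c) (End.hasEigenvalue_of_hasEigenvector
      (End.hasEigenvector_iff.mpr ⟨End.mem_eigenspace_iff.mpr hv, hv0⟩))
    simp only [Complex.add_re] at this
    linarith
  have hraise : ∀ v ∈ K, ∀ i j, i < j → E i j v = 0 := by
    intro v hv i j hij
    rw [hK, End.mem_eigenspace_iff, hH, LinearMap.sub_apply] at hv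
    have h0 := hE.apply_apply 0 0 i j v
    have h2 := hE.apply_apply 2 2 i j v
    have hd : H (E i j v) = E i j (E 0 0 v - E 2 2 v) + (((if 0 = i then E 0 j v else 0) -
      (if j = 0 then E i 0 v else 0)) - ((if 2 = i then E 2 j v else 0) -
      (if j = 2 then E i 2 v else 0))) := by
      rw [hH, LinearMap.sub_apply, h0, h2, map_sub]
      abel
    rw [hv, map_smul] at hd
    have hcases : (i = 0 ∧ j = 1) ∨ (i = 1 ∧ j = 2) ∨ (i = 0 ∧ j = 2) := by
      clear * - hij
      revert i j
      decide
    rcases hcases with ⟨rfl, rfl⟩ | ⟨rfl, rfl⟩ | ⟨rfl, rfl⟩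
    · refine hnot 1 (by simp) _ (hd.trans ?_)
      simp [add_smul]
    · refine hnot 1 (by simp) _ (hd.trans ?_)
      simp [add_smul]
    · refine hnot 2 (by simp) _ (hd.trans ?_)
      simp [add_smul, two_smul]
  have hinv : ∀ v ∈ K, E 1 1 v ∈ K := by
    intro v hv
    rw [hK, End.mem_eigenspace_iff, hH, LinearMap.sub_apply] at hv ⊢
    rw [hE.apply_apply 0 0 1 1 v, hE.apply_apply 2 2 1 1 v]
    simp [← map_smul, ← hv]
  have : Nontrivial K := (Submodule.nontrivial_iff_ne_bot).mpr hz
  obtain ⟨b, hb⟩ := End.exists_eigenvalue ((E 1 1).restrict hinv)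
  obtain ⟨⟨v, hvK⟩, hv⟩ := hb.exists_hasEigenvector
  have hv0 : v ≠ 0 := fun h => hv.2 (Subtype.ext h)
  have hv1 : E 1 1 v = b • v := congrArg Subtype.val hv.apply_eq_smul
  have hvH : E 0 0 v - E 2 2 v = z • v := End.mem_eigenspace_iff.mp hvK
  have hsum : E 0 0 v + E 1 1 v + E 2 2 v = 0 := by
    have := congrArg (fun f : End ℂ V => f v) hE.sum_diag
    simpa [Fin.sum_univ_three] using this
  have h00 : E 0 0 v = ((z - b) / 2) • v := by
    have : (2 : ℂ) • E 0 0 v = (z - b) • v := by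
      rw [sub_smul, ← hvH, ← hv1, two_smul]
      rw [← sub_eq_zero, ← hsum]
      abel
    rw [div_eq_inv_mul, mul_smul, ← this, inv_smul_smul₀ two_ne_zero]
  have h22 : E 2 2 v = (-(z + b) / 2) • v := by
    have : E 2 2 v = E 0 0 v - z • v := by rw [← hvH]; abel
    rw [this, h00, ← sub_smul]
    congr 1
    ring
  refine ⟨![(z - b) / 2, b, -(z + b) / 2], v, hv0, fun i => ?_, hraise v hvK⟩
  fin_cases i
  · exact h00
  · exact hv1
  · exact h22

theorem IsHighestWeight.exists_nat {χ : Fin 3 → ℂ} {v : V} (hv : IsHighestWeight E χ v)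
    (hE : IsUnitRep E) [FiniteDimensional ℂ V] {i j : Fin 3} (hij : i < j) :
    ∃ n : ℕ, χ i - χ j = n ∧ n < finrank ℂ V :=
  sl2_highest_weight (hE.sl2_rel hij.ne).1 (hE.sl2_rel hij.ne).2.1 (hE.sl2_rel hij.ne).2.2
    hv.ne_zero (by rw [LinearMap.sub_apply, hv.diag, hv.diag, sub_smul]) (hv.raise i j hij)

theorem IsHighestWeight.sum_eq_zero {χ : Fin 3 → ℂ} {v : V} (hv : IsHighestWeight E χ v)
    (hE : IsUnitRep E) : ∑ i, χ i = 0 := by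
  have := congrArg (fun f : End ℂ V => f v) hE.sum_diag
  simp only [LinearMap.sum_apply, hv.diag, ← Finset.sum_smul, LinearMap.zero_apply] at this
  exact (smul_eq_zero.mp this).resolve_right hv.ne_zero

/-- The vectors obtained from `v` by `n` applications of the lowering operators `E 1 0`, `E 2 1`. -/
inductive Lowered (E : Fin 3 → Fin 3 → End ℂ V) (v : V) : ℕ → V → Prop
  | refl : Lowered E v 0 v
  | left {n : ℕ} {w : V} : Lowered E v n w → Lowered E v (n + 1) (E 1 0 w)
  | right {n : ℕ} {w : V} : Lowered E v n w → Lowered E v (n + 1) (E 2 1 w)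

/-- The subspace spanned by all lowered vectors. -/
def lowerSpan (E : Fin 3 → Fin 3 → End ℂ V) (v : V) : Submodule ℂ V :=
  Submodule.span ℂ {w | ∃ n, Lowered E v n w}

theorem lowerSpan_left {v w : V} (hw : w ∈ lowerSpan E v) : E 1 0 w ∈ lowerSpan E v := by
  induction hw using Submodule.span_induction with
  | mem w hw => obtain ⟨n, hw⟩ := hw; exact Submodule.subset_span ⟨n + 1, hw.left⟩
  | zero => simp
  | add x y _ _ hx hy => rw [map_add]; exact add_mem hx hy
  | smul c x _ hx => rw [map_smul]; exact Submodule.smul_mem _ c hx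

theorem lowerSpan_right {v w : V} (hw : w ∈ lowerSpan E v) : E 2 1 w ∈ lowerSpan E v := by
  induction hw using Submodule.span_induction with
  | mem w hw => obtain ⟨n, hw⟩ := hw; exact Submodule.subset_span ⟨n + 1, hw.right⟩
  | zero => simp
  | add x y _ _ hx hy => rw [map_add]; exact add_mem hx hy
  | smul c x _ hx => rw [map_smul]; exact Submodule.smul_mem _ c hx

/-- `E 1 0` lowers the entry 0 of the weight and `E 2 1` raises the entry 2, so each step decreases
their difference by exactly 1. This grades the lowered vectors by n. -/
theorem Lowered.exists_weight (hE : IsUnitRep E) {χ : Fin 3 → ℂ} {v : V}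
    (hv : IsHighestWeight E χ v) {n : ℕ} {w : V} (hw : Lowered E v n w) :
    ∃ ψ : Fin 3 → ℂ, ψ 0 - ψ 2 = χ 0 - χ 2 - n ∧ ∀ i, E i i w = ψ i • w := by
  induction hw with
  | refl => exact ⟨χ, by simp, hv.diag⟩
  | left _ ih =>
    obtain ⟨ψ, h, hψ⟩ := ih
    refine ⟨![ψ 0 - 1, ψ 1 + 1, ψ 2], ?_, fun i => ?_⟩
    · simp only [Matrix.cons_val]
      push_cast
      linear_combination h
    · rw [hE.apply_apply, hψ, map_smul]
      fin_cases i <;> simp <;> module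
  | right _ ih =>
    obtain ⟨ψ, h, hψ⟩ := ih
    refine ⟨![ψ 0, ψ 1 - 1, ψ 2 + 1], ?_, fun i => ?_⟩
    · simp only [Matrix.cons_val]
      push_cast
      linear_combination h
    · rw [hE.apply_apply, hψ, map_smul]
      fin_cases i <;> simp <;> module

/-- Commuting `E 0 1` and `E 1 2` past a lowering operator leaves at most diagonal operators, which
act on lowered vectors by scalars; induction ends at v, which both kill. `E 0 2` and `E 2 0` are
commutators of operators already treated. -/
theorem IsHighestWeight.isInvariant_lowerSpan (hE : IsUnitRep E) {χ : Fin 3 → ℂ} {v : V}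
    (hv : IsHighestWeight E χ v) : IsInvariant E (lowerSpan E v) := by
  have ext : ∀ X : End ℂ V, (∀ n w, Lowered E v n w → X w ∈ lowerSpan E v) →
      ∀ w ∈ lowerSpan E v, X w ∈ lowerSpan E v := by
    intro X hX w hw
    induction hw using Submodule.span_induction with
    | mem w hw => obtain ⟨n, hw⟩ := hw; exact hX n w hw
    | zero => simp
    | add x y _ _ hx hy => rw [map_add]; exact add_mem hx hy
    | smul c x _ hx => rw [map_smul]; exact Submodule.smul_mem _ c hx
  have hdiag : ∀ i, ∀ w ∈ lowerSpan E v, E i i w ∈ lowerSpan E v := by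
    refine fun i => ext _ fun n w hw => ?_
    obtain ⟨ψ, -, hψ⟩ := hw.exists_weight hE hv
    rw [hψ]
    exact Submodule.smul_mem _ _ (Submodule.subset_span ⟨n, hw⟩)
  have h01 : ∀ w ∈ lowerSpan E v, E 0 1 w ∈ lowerSpan E v := by
    refine ext _ fun n w hw => ?_
    induction hw with
    | refl => simp [hv.raise 0 1 (by decide)]
    | left hw ih =>
      rw [hE.apply_apply]
      have hm : _ ∈ lowerSpan E v := Submodule.subset_span ⟨_, hw⟩
      simpa using add_mem (lowerSpan_left ih) (sub_mem (hdiag 0 _ hm) (hdiag 1 _ hm))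
    | right hw ih =>
      rw [hE.apply_apply]
      simpa using lowerSpan_right ih
  have h12 : ∀ w ∈ lowerSpan E v, E 1 2 w ∈ lowerSpan E v := by
    refine ext _ fun n w hw => ?_
    induction hw with
    | refl => simp [hv.raise 1 2 (by decide)]
    | left hw ih =>
      rw [hE.apply_apply]
      simpa using lowerSpan_left ih
    | right hw ih =>
      rw [hE.apply_apply]
      have hm : _ ∈ lowerSpan E v := Submodule.subset_span ⟨_, hw⟩
      simpa using add_mem (lowerSpan_right ih) (sub_mem (hdiag 1 _ hm) (hdiag 2 _ hm))
  intro i j w hw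
  have hcases : i = j ∨ (i = 0 ∧ j = 1) ∨ (i = 1 ∧ j = 2) ∨ (i = 0 ∧ j = 2) ∨ (i = 1 ∧ j = 0) ∨
      (i = 2 ∧ j = 1) ∨ (i = 2 ∧ j = 0) := by
    clear * -
    revert i j
    decide
  rcases hcases with rfl | ⟨rfl, rfl⟩ | ⟨rfl, rfl⟩ | ⟨rfl, rfl⟩ | ⟨rfl, rfl⟩ | ⟨rfl, rfl⟩ |
    ⟨rfl, rfl⟩
  · exact hdiag i w hw
  · exact h01 w hw
  · exact h12 w hw
  · have h := hE.apply_apply 0 1 1 2 w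
    have : E 0 2 w = E 0 1 (E 1 2 w) - E 1 2 (E 0 1 w) := by rw [h]; simp
    rw [this]
    exact sub_mem (h01 _ (h12 _ hw)) (h12 _ (h01 _ hw))
  · exact lowerSpan_left hw
  · exact lowerSpan_right hw
  · have h := hE.apply_apply 2 1 1 0 w
    have : E 2 0 w = E 2 1 (E 1 0 w) - E 1 0 (E 2 1 w) := by rw [h]; simp
    rw [this]
    exact sub_mem (lowerSpan_right (lowerSpan_left hw)) (lowerSpan_left (lowerSpan_right hw))

/-- The highest weight space of a highest weight module is one-dimensional. -/
theorem IsHighestWeight.exists_eq_smul (hE : IsUnitRep E) {χ : Fin 3 → ℂ} {v : V}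
    (hv : IsHighestWeight E χ v) {x : V} (hx : x ∈ lowerSpan E v)
    (hx' : ∀ i, E i i x = χ i • x) : ∃ c : ℂ, x = c • v := by
  set H := E 0 0 - E 2 2 with hH
  set z := χ 0 - χ 2 with hz
  -- A vector lowered at least once has an eigenvalue of H other than z, so independence of
  -- eigenspaces leaves only multiples of v at z.
  have h1 : lowerSpan E v ≤ Submodule.span ℂ {v} ⊔ ⨆ (μ) (_ : μ ≠ z), H.eigenspace μ := by
    refine Submodule.span_le.mpr ?_
    rintro w ⟨n, hw⟩
    obtain ⟨ψ, hψ, hw'⟩ := hw.exists_weight hE hv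
    rcases n with _ | n
    · cases hw
      exact Submodule.mem_sup_left (Submodule.mem_span_singleton_self v)
    · refine Submodule.mem_sup_right (Submodule.mem_iSup_of_mem (ψ 0 - ψ 2)
        (Submodule.mem_iSup_of_mem ?_ (End.mem_eigenspace_iff.mpr ?_)))
      · rw [hψ, Ne, sub_eq_self]
        exact Nat.cast_ne_zero.mpr (Nat.succ_ne_zero n)
      · rw [hH, LinearMap.sub_apply, hw', hw', sub_smul]
  obtain ⟨y, hy, u, hu, rfl⟩ := Submodule.mem_sup.mp (h1 hx)
  obtain ⟨c, rfl⟩ := Submodule.mem_span_singleton.mp hy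
  refine ⟨c, ?_⟩
  have hmem : ∀ x : V, (∀ i, E i i x = χ i • x) → x ∈ H.eigenspace z := fun x hx =>
    End.mem_eigenspace_iff.mpr (by rw [hH, LinearMap.sub_apply, hx, hx, sub_smul])
  have hu' : u ∈ H.eigenspace z := by
    have := sub_mem (hmem _ hx') (Submodule.smul_mem _ c (hmem v hv.diag))
    rwa [add_sub_cancel_left] at this
  rw [Submodule.disjoint_def.mp (H.eigenspaces_iSupIndep z) u hu' hu, add_zero]

/-- Irreducibility of a family of operators. -/
def IsIrreducibleFamily (E : Fin 3 → Fin 3 → End ℂ V) : Prop :=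
  Nontrivial V ∧ ∀ U : Submodule ℂ V, IsInvariant E U → U = ⊥ ∨ U = ⊤

theorem IsUnitRep.prodMap (hE : IsUnitRep E) (hF : IsUnitRep F) :
    IsUnitRep fun i j => (E i j).prodMap (F i j) where
  comm i j k l := by
    refine LinearMap.ext fun v => ?_
    have h1 := congrArg (fun f : End ℂ V => f v.1) (hE.comm i j k l)
    have h2 := congrArg (fun f : End ℂ W => f v.2) (hF.comm i j k l)
    split_ifs at h1 h2 ⊢ <;> exact Prod.ext h1 h2
  sum_diag := by
    refine LinearMap.ext fun v => ?_
    have h1 := congrArg (fun f : End ℂ V => f v.1) hE.sum_diag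
    have h2 := congrArg (fun f : End ℂ W => f v.2) hF.sum_diag
    simp only [Fin.sum_univ_three] at h1 h2 ⊢
    exact Prod.ext h1 h2

/-- Irreducible representations with the same highest weight are isomorphic. -/
theorem exists_linearEquiv_of_isHighestWeight (hE : IsUnitRep E) (hF : IsUnitRep F)
    (hiE : IsIrreducibleFamily E) (hiF : IsIrreducibleFamily F) {χ : Fin 3 → ℂ} {v : V} {w : W}
    (hv : IsHighestWeight E χ v) (hw : IsHighestWeight F χ w) :
    ∃ e : V ≃ₗ[ℂ] W, ∀ i j x, e (E i j x) = F i j (e x) := by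
  set G : Fin 3 → Fin 3 → End ℂ (V × W) := fun i j => (E i j).prodMap (F i j) with hG
  have hGr : IsUnitRep G := hE.prodMap hF
  have hvw : IsHighestWeight G χ (v, w) :=
    ⟨fun h => hv.ne_zero (Prod.ext_iff.mp h).1, fun i => Prod.ext (hv.diag i) (hw.diag i),
      fun i j hij => Prod.ext (hv.raise i j hij) (hw.raise i j hij)⟩
  -- N will be the graph of the isomorphism: both coordinate projections from N turn out to be
  -- bijective.
  set N := lowerSpan G (v, w) with hN
  have hNinv : IsInvariant G N := hvw.isInvariant_lowerSpan hGr
  have hmem : (v, w) ∈ N := Submodule.subset_span ⟨0, .refl⟩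
  have hfst : Function.Bijective (LinearMap.fst ℂ V W ∘ₗ N.subtype) := by
    constructor
    · have hU : N.comap (LinearMap.inr ℂ V W) = ⊥ := by
        refine (hiF.2 _ fun i j x hx => ?_).resolve_right fun h => ?_
        · have := hNinv i j _ hx
          simpa [hG] using this
        · have h0 : ((0 : V), w) ∈ N := by
            have : w ∈ N.comap (LinearMap.inr ℂ V W) := h ▸ Submodule.mem_top
            simpa using this
          obtain ⟨c, hc⟩ := hvw.exists_eq_smul hGr h0
            fun i => Prod.ext (by simp [hG]) (by simpa [hG] using hw.diag i)
          have h1 : (0 : V) = c • v := (Prod.ext_iff.mp hc).1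
          have h2 : w = c • w := (Prod.ext_iff.mp hc).2
          rw [(smul_eq_zero.mp h1.symm).resolve_right hv.ne_zero, zero_smul] at h2
          exact hw.ne_zero h2
      refine (injective_iff_map_eq_zero _).mpr ?_
      rintro ⟨⟨x, y⟩, hxy⟩ h
      obtain rfl : x = 0 := h
      have : y ∈ N.comap (LinearMap.inr ℂ V W) := hxy
      rw [hU, Submodule.mem_bot] at this
      subst this
      rfl
    · refine LinearMap.range_eq_top.mp ((hiE.2 _ ?_).resolve_left fun h => ?_)
      · rintro i j _ ⟨x, rfl⟩
        exact ⟨⟨_, hNinv i j x x.2⟩, rfl⟩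
      · have : v ∈ LinearMap.range (LinearMap.fst ℂ V W ∘ₗ N.subtype) := ⟨⟨_, hmem⟩, rfl⟩
        rw [h, Submodule.mem_bot] at this
        exact hv.ne_zero this
  have hsnd : Function.Bijective (LinearMap.snd ℂ V W ∘ₗ N.subtype) := by
    constructor
    · have hU : N.comap (LinearMap.inl ℂ V W) = ⊥ := by
        refine (hiE.2 _ fun i j x hx => ?_).resolve_right fun h => ?_
        · have := hNinv i j _ hx
          simpa [hG] using this
        · have h0 : (v, (0 : W)) ∈ N := by
            have : v ∈ N.comap (LinearMap.inl ℂ V W) := h ▸ Submodule.mem_top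
            simpa using this
          obtain ⟨c, hc⟩ := hvw.exists_eq_smul hGr h0
            fun i => Prod.ext (by simpa [hG] using hv.diag i) (by simp [hG])
          have h1 : (0 : W) = c • w := (Prod.ext_iff.mp hc).2
          have h2 : v = c • v := (Prod.ext_iff.mp hc).1
          rw [(smul_eq_zero.mp h1.symm).resolve_right hw.ne_zero, zero_smul] at h2
          exact hv.ne_zero h2
      refine (injective_iff_map_eq_zero _).mpr ?_
      rintro ⟨⟨x, y⟩, hxy⟩ h
      obtain rfl : y = 0 := h
      have : x ∈ N.comap (LinearMap.inl ℂ V W) := hxy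
      rw [hU, Submodule.mem_bot] at this
      subst this
      rfl
    · refine LinearMap.range_eq_top.mp ((hiF.2 _ ?_).resolve_left fun h => ?_)
      · rintro i j _ ⟨x, rfl⟩
        exact ⟨⟨_, hNinv i j x x.2⟩, rfl⟩
      · have : w ∈ LinearMap.range (LinearMap.snd ℂ V W ∘ₗ N.subtype) := ⟨⟨_, hmem⟩, rfl⟩
        rw [h, Submodule.mem_bot] at this
        exact hw.ne_zero this
  set f := LinearEquiv.ofBijective _ hfst with hf
  set g := LinearEquiv.ofBijective _ hsnd with hg
  refine ⟨f.symm.trans g, fun i j x => ?_⟩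
  obtain ⟨n, rfl⟩ := f.surjective x
  have h1 : E i j (f n) = f ⟨G i j n, hNinv i j n n.2⟩ := rfl
  rw [h1, LinearEquiv.trans_apply, LinearEquiv.trans_apply, f.symm_apply_apply, f.symm_apply_apply]
  rfl

end


/-! ### Complexification of su(3) to gl₃ -/

open Matrix

attribute [local instance] LieRing.ofAssociativeRing

theorem su3.conjTranspose_coe (P : su3) : (P : Matrix (Fin 3) (Fin 3) ℂ)ᴴ = -P := P.2.1

theorem su3.trace_coe (P : su3) : (P : Matrix (Fin 3) (Fin 3) ℂ).trace = 0 := P.2.2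

/-- The traceless part of a matrix. -/
noncomputable def tracelessPart (X : Matrix (Fin 3) (Fin 3) ℂ) : Matrix (Fin 3) (Fin 3) ℂ :=
  X - (X.trace / 3) • 1

theorem trace_tracelessPart (X : Matrix (Fin 3) (Fin 3) ℂ) : (tracelessPart X).trace = 0 := by
  simp [tracelessPart, Matrix.trace_sub, Matrix.trace_smul]

/-- The skew-Hermitian part of the traceless part of a matrix. -/
noncomputable def skewPart (X : Matrix (Fin 3) (Fin 3) ℂ) : su3 :=
  ⟨(1 / 2 : ℂ) • (tracelessPart X - (tracelessPart X)ᴴ), by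
    constructor
    · rw [conjTranspose_smul, conjTranspose_sub, conjTranspose_conjTranspose, ← smul_neg, neg_sub]
      simp
    · rw [Matrix.trace_smul, Matrix.trace_sub, Matrix.trace_conjTranspose, trace_tracelessPart]
      simp⟩

/-- The Hermitian part of the traceless part of a matrix, divided by `I`. -/
noncomputable def hermPart (X : Matrix (Fin 3) (Fin 3) ℂ) : su3 :=
  ⟨(-Complex.I / 2 : ℂ) • (tracelessPart X + (tracelessPart X)ᴴ), by
    constructor
    · rw [conjTranspose_smul, conjTranspose_add, conjTranspose_conjTranspose, ← neg_smul, add_comm]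
      congr 1
      simp [neg_div]
    · rw [Matrix.trace_smul, Matrix.trace_add, Matrix.trace_conjTranspose, trace_tracelessPart]
      simp⟩

/-- Existence in the decomposition gl₃ = su(3) ⊕ i su(3) ⊕ ℂ; `skewPart_add` and `hermPart_add`
supply uniqueness. Together they make the extension of ρ linear and bracket-preserving. -/
theorem eq_skewPart_add_hermPart (X : Matrix (Fin 3) (Fin 3) ℂ) :
    X = (skewPart X : Matrix (Fin 3) (Fin 3) ℂ) + Complex.I • (hermPart X) +
      (X.trace / 3) • (1 : Matrix (Fin 3) (Fin 3) ℂ) := by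
  have h : (Complex.I * (-Complex.I / 2) : ℂ) = 1 / 2 := by
    rw [mul_div_assoc', mul_neg, Complex.I_mul_I, neg_neg]
  simp only [skewPart, hermPart, smul_smul, h, ← smul_add]
  have h2 : tracelessPart X - (tracelessPart X)ᴴ + (tracelessPart X + (tracelessPart X)ᴴ) =
      (2 : ℂ) • tracelessPart X := by
    rw [two_smul]; abel
  rw [h2, smul_smul]
  norm_num [tracelessPart]

theorem tracelessPart_add (P Q : su3) (c : ℂ) :
    tracelessPart ((P : Matrix (Fin 3) (Fin 3) ℂ) + Complex.I • (Q : Matrix (Fin 3) (Fin 3) ℂ) +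
      c • 1) = (P : Matrix (Fin 3) (Fin 3) ℂ) + Complex.I • (Q : Matrix (Fin 3) (Fin 3) ℂ) := by
  simp [tracelessPart, Matrix.trace_add, Matrix.trace_smul, su3.trace_coe]

theorem skewPart_add (P Q : su3) (c : ℂ) :
    skewPart ((P : Matrix (Fin 3) (Fin 3) ℂ) + Complex.I • (Q : Matrix (Fin 3) (Fin 3) ℂ) +
      c • 1) = P := by
  refine Subtype.ext ?_
  simp only [skewPart, tracelessPart_add, conjTranspose_add, conjTranspose_smul,
    su3.conjTranspose_coe, Complex.star_def, Complex.conj_I]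
  module

theorem hermPart_add (P Q : su3) (c : ℂ) :
    hermPart ((P : Matrix (Fin 3) (Fin 3) ℂ) + Complex.I • (Q : Matrix (Fin 3) (Fin 3) ℂ) +
      c • 1) = Q := by
  refine Subtype.ext ?_
  simp only [hermPart, tracelessPart_add, conjTranspose_add, conjTranspose_smul,
    su3.conjTranspose_coe, Complex.star_def, Complex.conj_I]
  have h : (-Complex.I / 2 * (2 * Complex.I) : ℂ) = 1 := by
    linear_combination - Complex.I_mul_I
  have h2 : (P : Matrix (Fin 3) (Fin 3) ℂ) + Complex.I • (Q : Matrix (Fin 3) (Fin 3) ℂ) +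
      (-P + -Complex.I • -(Q : Matrix (Fin 3) (Fin 3) ℂ)) =
      (2 * Complex.I) • (Q : Matrix (Fin 3) (Fin 3) ℂ) := by
    module
  rw [h2, smul_smul, h, one_smul]

section

variable {V : Type} [AddCommGroup V] [Module ℂ V] (ρ : Rep V)

theorem Rep.map_real_smul (a : ℝ) (P : su3) : ρ (a • P) = (a : ℂ) • ρ P := by
  rw [map_smul]
  rfl

theorem Rep.map_lie' (P Q : su3) : ρ ⁅P, Q⁆ = ρ P * ρ Q - ρ Q * ρ P := by
  rw [LieHom.map_lie, Ring.lie_def]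

/-- The value of the complexified representation. -/
noncomputable def Rep.complexifyFun (X : Matrix (Fin 3) (Fin 3) ℂ) : End ℂ V :=
  ρ (skewPart X) + Complex.I • ρ (hermPart X)

theorem Rep.complexifyFun_add_smul (P Q : su3) (c : ℂ) :
    Rep.complexifyFun ρ ((P : Matrix (Fin 3) (Fin 3) ℂ) +
      Complex.I • (Q : Matrix (Fin 3) (Fin 3) ℂ) + c • 1) = ρ P + Complex.I • ρ Q := by
  rw [complexifyFun, skewPart_add, hermPart_add]

/-- The extension of a representation of `su(3)` to a representation of `gl₃` in which the scalar
matrices act by zero. -/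
noncomputable def Rep.complexify : Matrix (Fin 3) (Fin 3) ℂ →ₗ[ℂ] End ℂ V where
  toFun := Rep.complexifyFun ρ
  map_add' X Y := by
    have h : X + Y = ((skewPart X + skewPart Y : su3) : Matrix (Fin 3) (Fin 3) ℂ) +
        Complex.I • ((hermPart X + hermPart Y : su3) : Matrix (Fin 3) (Fin 3) ℂ) +
        (X.trace / 3 + Y.trace / 3) • 1 := by
      nth_rewrite 1 [eq_skewPart_add_hermPart X, eq_skewPart_add_hermPart Y]
      push_cast
      module
    rw [h, complexifyFun_add_smul, map_add, map_add, complexifyFun, complexifyFun]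
    module
  map_smul' c X := by
    have h : c • X = ((c.re • skewPart X - c.im • hermPart X : su3) : Matrix (Fin 3) (Fin 3) ℂ) +
        Complex.I • ((c.re • hermPart X + c.im • skewPart X : su3) : Matrix (Fin 3) (Fin 3) ℂ) +
        (c * (X.trace / 3)) • 1 := by
      nth_rewrite 1 [eq_skewPart_add_hermPart X, ← c.re_add_im]
      have hr : ∀ (a : ℝ) (A : Matrix (Fin 3) (Fin 3) ℂ), a • A = (a : ℂ) • A := fun _ _ => rfl
      push_cast [hr]
      have hI : (c.re + c.im * Complex.I) * Complex.I = -c.im + Complex.I * c.re := by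
        linear_combination c.im * Complex.I_mul_I
      rw [smul_add, smul_add, smul_smul, smul_smul, hI, c.re_add_im]
      nth_rewrite 1 [← c.re_add_im]
      module
    rw [h, complexifyFun_add_smul, map_sub, map_add, map_real_smul, map_real_smul, map_real_smul,
      map_real_smul, complexifyFun, RingHom.id_apply]
    conv_rhs => rw [← c.re_add_im]
    rw [smul_add ((c.re : ℂ) + c.im * Complex.I), smul_smul _ Complex.I,
      show (c.re + c.im * Complex.I) * Complex.I = -c.im + Complex.I * c.re by
        linear_combination c.im * Complex.I_mul_I]
    module

theorem Rep.complexify_add_smul (P Q : su3) (c : ℂ) :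
    Rep.complexify ρ ((P : Matrix (Fin 3) (Fin 3) ℂ) +
      Complex.I • (Q : Matrix (Fin 3) (Fin 3) ℂ) + c • 1) = ρ P + Complex.I • ρ Q :=
  Rep.complexifyFun_add_smul ρ P Q c

theorem Rep.complexify_coe (P : su3) : Rep.complexify ρ P = ρ P := by
  simpa using Rep.complexify_add_smul ρ P 0 0

theorem Rep.complexify_commutator (X Y : Matrix (Fin 3) (Fin 3) ℂ) :
    Rep.complexify ρ (X * Y - Y * X) = Rep.complexify ρ X * Rep.complexify ρ Y -
      Rep.complexify ρ Y * Rep.complexify ρ X := by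
  obtain ⟨P, Q, c, rfl⟩ : ∃ (P Q : su3) (c : ℂ),
      X = (P : Matrix (Fin 3) (Fin 3) ℂ) + Complex.I • (Q : Matrix (Fin 3) (Fin 3) ℂ) + c • 1 :=
    ⟨_, _, _, eq_skewPart_add_hermPart X⟩
  obtain ⟨P', Q', c', rfl⟩ : ∃ (P Q : su3) (c : ℂ),
      Y = (P : Matrix (Fin 3) (Fin 3) ℂ) + Complex.I • (Q : Matrix (Fin 3) (Fin 3) ℂ) + c • 1 :=
    ⟨_, _, _, eq_skewPart_add_hermPart Y⟩
  have key : ∀ {A : Type} [Ring A] [Algebra ℂ A] (p q p' q' : A),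
      (p + Complex.I • q) * (p' + Complex.I • q') - (p' + Complex.I • q') * (p + Complex.I • q) =
      ((p * p' - p' * p) - (q * q' - q' * q)) +
        Complex.I • ((p * q' - q' * p) + (q * p' - p' * q)) := by
    intro A _ _ p q p' q'
    simp only [mul_add, add_mul, smul_mul_assoc, mul_smul_comm, smul_add, smul_sub, smul_smul,
      Complex.I_mul_I]
    module
  have scalar : ∀ {A : Type} [Ring A] [Algebra ℂ A] (x y : A),
      (x + c • 1) * (y + c' • 1) - (y + c' • 1) * (x + c • 1) = x * y - y * x := by
    intro A _ _ x y
    simp only [mul_add, add_mul, smul_mul_assoc, mul_smul_comm, one_mul, mul_one]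
    module
  have h : ((P : Matrix (Fin 3) (Fin 3) ℂ) + Complex.I • (Q : Matrix (Fin 3) (Fin 3) ℂ) + c • 1) *
      ((P' : Matrix (Fin 3) (Fin 3) ℂ) + Complex.I • (Q' : Matrix (Fin 3) (Fin 3) ℂ) + c' • 1) -
      ((P' : Matrix (Fin 3) (Fin 3) ℂ) + Complex.I • (Q' : Matrix (Fin 3) (Fin 3) ℂ) + c' • 1) *
      ((P : Matrix (Fin 3) (Fin 3) ℂ) + Complex.I • (Q : Matrix (Fin 3) (Fin 3) ℂ) + c • 1) =
      ((⁅P, P'⁆ - ⁅Q, Q'⁆ : su3) : Matrix (Fin 3) (Fin 3) ℂ) +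
      Complex.I • ((⁅P, Q'⁆ + ⁅Q, P'⁆ : su3) : Matrix (Fin 3) (Fin 3) ℂ) + (0 : ℂ) • 1 := by
    rw [scalar, key, zero_smul, add_zero]
    rfl
  rw [h]
  rw [complexify_add_smul, complexify_add_smul, complexify_add_smul, key, map_sub, map_add,
    Rep.map_lie', Rep.map_lie', Rep.map_lie', Rep.map_lie']

/-- The operators of the matrix units. -/
noncomputable def Rep.units (i j : Fin 3) : End ℂ V := Rep.complexify ρ (single i j 1)

theorem Rep.isUnitRep_units : IsUnitRep (Rep.units ρ) where
  comm i j k l := by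
    have h : ∀ i j k l : Fin 3, (single i j 1 * single k l 1 : Matrix (Fin 3) (Fin 3) ℂ) =
        if j = k then single i l 1 else 0 := by
      intro i j k l
      split_ifs with hjk
      · rw [hjk, single_mul_single_same, one_mul]
      · rw [single_mul_single_of_ne _ _ _ _ hjk]
    simp only [units]
    rw [← complexify_commutator, h, h, map_sub]
    congr 1 <;> split_ifs <;> simp
  sum_diag := by
    simp only [units]
    rw [← map_sum]
    have h : ∑ i : Fin 3, (single i i 1 : Matrix (Fin 3) (Fin 3) ℂ) = 1 := by
      ext i j
      rw [Fin.sum_univ_three]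
      fin_cases i <;> fin_cases j <;> simp
    simpa [h] using complexify_add_smul ρ 0 0 1

theorem Rep.apply_eq_sum_units (P : su3) :
    ρ P = ∑ i, ∑ j, (P : Matrix (Fin 3) (Fin 3) ℂ) i j • Rep.units ρ i j := by
  rw [← complexify_coe]
  conv_lhs => rw [matrix_eq_sum_single (P : Matrix (Fin 3) (Fin 3) ℂ)]
  simp only [map_sum, units, ← map_smul, smul_single, smul_eq_mul, mul_one]

/-- Each family of operators lies in the complex span of the other, and W is a complex subspace.
This carries reducibility questions between su(3) and gl₃. -/
theorem Rep.isInvariant_units_iff (W : Submodule ℂ V) :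
    IsInvariant (Rep.units ρ) W ↔ ∀ P : su3, ∀ v ∈ W, ρ P v ∈ W := by
  refine ⟨fun h P v hv => ?_, fun h i j v hv => ?_⟩
  · rw [Rep.apply_eq_sum_units]
    simp only [LinearMap.sum_apply, LinearMap.smul_apply]
    exact sum_mem fun i _ => sum_mem fun j _ => W.smul_mem _ (h i j v hv)
  · exact add_mem (h _ v hv) (W.smul_mem _ (h _ v hv))

theorem Rep.isIrreducibleFamily_units_iff :
    IsIrreducibleFamily (Rep.units ρ) ↔ IsIrreducible ρ := by
  simp only [IsIrreducibleFamily, IsIrreducible, Rep.isInvariant_units_iff]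

/-- Complete reducibility of finite-dimensional representations of `su(3)`. -/
theorem Rep.exists_isCompl [FiniteDimensional ℂ V] {W : Submodule ℂ V}
    (hW : ∀ P : su3, ∀ v ∈ W, ρ P v ∈ W) :
    ∃ W' : Submodule ℂ V, (∀ P : su3, ∀ v ∈ W', ρ P v ∈ W') ∧ IsCompl W W' := by
  simp only [← Rep.isInvariant_units_iff] at hW ⊢
  exact (Rep.isUnitRep_units ρ).exists_isCompl hW

end

/-! ### Finiteness of the number of irreducibles -/

/-- There are finitely many irreducible representations in each dimension. -/
theorem finite_irrClass (n : ℕ) : (irrClass n).Finite := by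
  have hχ : ∀ c : irrClass n, ∃ (ρ : Rep (Fin n → ℂ)) (χ : Fin 3 → ℂ) (v : Fin n → ℂ)
      (a b : Fin n), IsIrreducible ρ ∧ (Quotient.mk (repSetoid n) ρ : ModClass n) = c.1 ∧
      IsHighestWeight (Rep.units ρ) χ v ∧ χ 0 - χ 1 = (a : ℕ) ∧ χ 1 - χ 2 = (b : ℕ) := by
    rintro ⟨c, ρ, hρ, rfl⟩
    have := hρ.1
    obtain ⟨χ, v, hv⟩ := (Rep.isUnitRep_units ρ).exists_isHighestWeight
    obtain ⟨a, ha, ha'⟩ := hv.exists_nat (Rep.isUnitRep_units ρ) (i := 0) (j := 1) (by decide)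
    obtain ⟨b, hb, hb'⟩ := hv.exists_nat (Rep.isUnitRep_units ρ) (i := 1) (j := 2) (by decide)
    rw [Module.finrank_fin_fun] at ha' hb'
    exact ⟨ρ, χ, v, ⟨a, ha'⟩, ⟨b, hb'⟩, hρ, rfl, hv, ha, hb⟩
  choose ρ χ v a b hρ hc hv ha hb using hχ
  -- The two differences together with the zero sum recover χ, and χ recovers the class; so the
  -- classes embed in `Fin n × Fin n`.
  have hinj : Function.Injective fun c => (a c, b c) := by
    intro c d hcd
    simp only [Prod.mk.injEq] at hcd
    have h01 := (hcd.1 ▸ ha c).trans (ha d).symm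
    have h12 := (hcd.2 ▸ hb c).trans (hb d).symm
    have hs := (hv c).sum_eq_zero (Rep.isUnitRep_units _)
    have hs' := (hv d).sum_eq_zero (Rep.isUnitRep_units _)
    rw [Fin.sum_univ_three] at hs hs'
    have hχ : χ c = χ d := by
      funext i
      fin_cases i <;> simp only [Fin.zero_eta, Fin.mk_one, Fin.reduceFinMk]
      · linear_combination (1 / 3) * (hs - hs' + 2 * h01 + h12)
      · linear_combination (1 / 3) * (hs - hs' - h01 + h12)
      · linear_combination (1 / 3) * (hs - hs' - h01 - 2 * h12)
    obtain ⟨e, he⟩ := exists_linearEquiv_of_isHighestWeight (Rep.isUnitRep_units _)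
      (Rep.isUnitRep_units _) ((Rep.isIrreducibleFamily_units_iff _).mpr (hρ c))
      ((Rep.isIrreducibleFamily_units_iff _).mpr (hρ d)) (hv c) (hχ ▸ hv d)
    refine Subtype.ext ?_
    rw [← hc, ← hc]
    refine Quotient.sound ⟨e, fun P x => ?_⟩
    simp [Rep.apply_eq_sum_units, he]
  have : Finite (irrClass n) := Finite.of_injective _ hinj
  exact Set.toFinite _


/-! ### Intertwiners, direct sums and Schur's lemma -/

section

variable {U V W : Type} [AddCommGroup U] [Module ℂ U] [AddCommGroup V] [Module ℂ V]
  [AddCommGroup W] [Module ℂ W]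

theorem Equivalent.refl (ρ : Rep V) : Equivalent ρ ρ := ⟨LinearEquiv.refl ℂ V, fun _ _ => rfl⟩

theorem Equivalent.symm {ρ : Rep V} {σ : Rep W} : Equivalent ρ σ → Equivalent σ ρ := by
  rintro ⟨e, he⟩
  exact ⟨e.symm, fun x v => by rw [LinearEquiv.symm_apply_eq, he, LinearEquiv.apply_symm_apply]⟩

theorem Equivalent.trans {ρ : Rep U} {σ : Rep V} {τ : Rep W} :
    Equivalent ρ σ → Equivalent σ τ → Equivalent ρ τ := by
  rintro ⟨e, he⟩ ⟨f, hf⟩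
  exact ⟨e.trans f, fun x v => by rw [LinearEquiv.trans_apply, LinearEquiv.trans_apply, he, hf]⟩

/-- Transport of a representation along a linear equivalence. -/
noncomputable def Rep.transport (ρ : Rep V) (e : V ≃ₗ[ℂ] W) : Rep W where
  toFun x := e.conj (ρ x)
  map_add' x y := by rw [map_add, map_add]
  map_smul' c x := by
    rw [Rep.map_real_smul, map_smul]
    rfl
  map_lie' {x y} := by
    rw [Rep.map_lie', map_sub, Ring.lie_def]
    congr 1 <;> ext <;> simp [LinearEquiv.conj_apply_apply]

theorem Rep.equivalent_transport (ρ : Rep V) (e : V ≃ₗ[ℂ] W) : Equivalent ρ (ρ.transport e) :=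
  ⟨e, fun x v => by simp [transport, LinearEquiv.conj_apply_apply]⟩

/-- The restriction of a representation to an invariant subspace. -/
noncomputable def Rep.restrict (ρ : Rep V) (W : Submodule ℂ V)
    
    (hW : ∀ x, ∀ v ∈ W, ρ x v ∈ W) : Rep W where
  toFun x := (ρ x).restrict (hW x)
  map_add' x y := by ext v; simp
  map_smul' c x := by ext v; simp
  map_lie' {x y} := by
    ext v
    simp [Ring.lie_def]

/-- The direct sum of a finite family of representations. -/
noncomputable def Rep.pi {ι : Type} {M : ι → Type} [∀ i, AddCommGroup (M i)] [∀ i, Module ℂ (M i)]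
    (ρ : ∀ i, Rep (M i)) : Rep (∀ i, M i) where
  toFun x := LinearMap.pi fun i => ρ i x ∘ₗ LinearMap.proj i
  map_add' x y := by ext v; simp
  map_smul' c x := by
    refine LinearMap.ext fun v => funext fun i => ?_
    simp
  map_lie' {x y} := by
    refine LinearMap.ext fun v => funext fun i => ?_
    simp [Ring.lie_def]

theorem Rep.pi_apply {ι : Type} {M : ι → Type} [∀ i, AddCommGroup (M i)] [∀ i, Module ℂ (M i)]
    (ρ : ∀ i, Rep (M i)) (x : su3) (v : ∀ i, M i) (i : ι) : Rep.pi ρ x v i = ρ i x (v i) := rfl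

/-- The space of intertwining operators. -/
def intertwiners (ρ : Rep V) (σ : Rep W) : Submodule ℂ (V →ₗ[ℂ] W) where
  carrier := {f | ∀ x v, f (ρ x v) = σ x (f v)}
  zero_mem' x v := by simp
  add_mem' {f g} hf hg x v := by
    rw [LinearMap.add_apply, hf x v, hg x v, LinearMap.add_apply, map_add]
  smul_mem' c f hf x v := by rw [LinearMap.smul_apply, hf x v, LinearMap.smul_apply, map_smul]

theorem finrank_intertwiners_congr (ρ : Rep U) {σ : Rep V} {τ : Rep W} (h : Equivalent σ τ) :
    finrank ℂ (intertwiners ρ σ) = finrank ℂ (intertwiners ρ τ) := by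
  obtain ⟨e, he⟩ := h
  refine LinearEquiv.finrank_eq
    { toFun := fun f => ⟨e.toLinearMap ∘ₗ f.1, fun x v => ?_⟩
      map_add' := fun f g => Subtype.ext (by ext; simp)
      map_smul' := fun c f => Subtype.ext (by ext; simp)
      invFun := fun f => ⟨e.symm.toLinearMap ∘ₗ f.1, fun x v => ?_⟩
      left_inv := fun f => Subtype.ext (by ext; simp)
      right_inv := fun f => Subtype.ext (by ext; simp) }
  · simp [f.2 x v, he]
  · simp [f.2 x v, LinearEquiv.symm_apply_eq, he]

theorem finrank_intertwiners_pi {ι : Type} [Fintype ι] {M : ι → Type} [∀ i, AddCommGroup (M i)]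
    [∀ i, Module ℂ (M i)] [∀ i, FiniteDimensional ℂ (M i)] [FiniteDimensional ℂ V]
    (ρ : Rep V) (σ : ∀ i, Rep (M i)) :
    finrank ℂ (intertwiners ρ (Rep.pi σ)) = ∑ i, finrank ℂ (intertwiners ρ (σ i)) := by
  rw [← Module.finrank_pi_fintype]
  refine LinearEquiv.finrank_eq
    { toFun := fun f i => ⟨LinearMap.proj i ∘ₗ f.1, fun x v => ?_⟩
      map_add' := fun f g => funext fun i => Subtype.ext (by ext; simp)
      map_smul' := fun c f => funext fun i => Subtype.ext (by ext; simp)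
      invFun := fun f => ⟨LinearMap.pi fun i => (f i).1, fun x v => ?_⟩
      left_inv := fun f => Subtype.ext (by ext; simp)
      right_inv := fun f => funext fun i => Subtype.ext (by ext; simp) }
  · simp [f.2 x v, Rep.pi_apply]
  · funext i
    simp [(f i).2 x v, Rep.pi_apply]

theorem IsIrreducible.eq_zero_or_bijective {ρ : Rep V} {σ : Rep W} (hρ : IsIrreducible ρ)
    (hσ : IsIrreducible σ) {f : V →ₗ[ℂ] W} (hf : f ∈ intertwiners ρ σ) :
    f = 0 ∨ Function.Bijective f := by
  rcases hρ.2 (LinearMap.ker f) (fun x v hv => by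
    rw [LinearMap.mem_ker] at hv ⊢; rw [hf x v, hv, map_zero]) with hk | hk
  · rcases hσ.2 (LinearMap.range f) (by
      rintro x _ ⟨v, rfl⟩
      exact ⟨ρ x v, hf x v⟩) with hr | hr
    · exact Or.inl (LinearMap.range_eq_bot.mp hr)
    · exact Or.inr ⟨LinearMap.ker_eq_bot.mp hk, LinearMap.range_eq_top.mp hr⟩
  · exact Or.inl (LinearMap.ker_eq_top.mp hk)

/-- Schur's lemma for inequivalent representations. -/
theorem IsIrreducible.finrank_intertwiners_of_not_equivalent {ρ : Rep V} {σ : Rep W}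
    (hρ : IsIrreducible ρ) (hσ : IsIrreducible σ) (h : ¬ Equivalent ρ σ) :
    finrank ℂ (intertwiners ρ σ) = 0 := by
  have : intertwiners ρ σ = ⊥ := by
    refine (Submodule.eq_bot_iff _).mpr fun f hf => ?_
    refine (hρ.eq_zero_or_bijective hσ hf).resolve_right fun hb => h ?_
    exact ⟨LinearEquiv.ofBijective f hb, hf⟩
  rw [this, finrank_bot]

/-- Schur's lemma for equivalent representations. -/
theorem IsIrreducible.finrank_intertwiners_of_equivalent [FiniteDimensional ℂ V] {ρ : Rep V}
    {σ : Rep W} (hρ : IsIrreducible ρ) (hσ : IsIrreducible σ) (h : Equivalent ρ σ) :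
    finrank ℂ (intertwiners ρ σ) = 1 := by
  obtain ⟨e, he⟩ := h
  have := hρ.1
  have hmem : e.toLinearMap ∈ intertwiners ρ σ := he
  obtain ⟨v₀, hv₀⟩ := exists_ne (0 : V)
  refine finrank_eq_one ⟨e.toLinearMap, hmem⟩ (fun h0 => hv₀ ?_) ?_
  · have := congrArg (fun f : intertwiners ρ σ => (f : V →ₗ[ℂ] W) v₀) h0
    simpa using this
  · rintro ⟨f, hf⟩
    obtain ⟨c, hc⟩ := End.exists_eigenvalue (e.symm.toLinearMap ∘ₗ f : End ℂ V)
    obtain ⟨v, hv⟩ := hc.exists_hasEigenvector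
    have hfv : f v = c • e v := by
      have := hv.apply_eq_smul
      rw [LinearMap.comp_apply, LinearEquiv.coe_coe, LinearEquiv.symm_apply_eq, map_smul] at this
      exact this
    refine ⟨c, Subtype.ext ?_⟩
    -- The intertwiner c e - f kills the eigenvector v, so it is not injective and must be zero.
    have hg := sub_mem ((intertwiners ρ σ).smul_mem c hmem) hf
    rcases hρ.eq_zero_or_bijective hσ hg with h0 | hb
    · exact sub_eq_zero.mp h0
    · refine absurd (hb.1 (a₁ := v) (a₂ := 0) ?_) hv.2
      simp [hfv]

theorem IsIrreducible.congr {ρ : Rep V} {σ : Rep W} (hρ : IsIrreducible ρ) (h : Equivalent ρ σ) :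
    IsIrreducible σ := by
  obtain ⟨e, he⟩ := h
  have := hρ.1
  refine ⟨e.symm.toEquiv.nontrivial, fun N hN => ?_⟩
  rcases hρ.2 (N.comap e.toLinearMap) (fun x v hv => by
    have := hN x _ hv
    rw [Submodule.mem_comap]
    simpa [he] using this) with h | h
  · left
    rw [eq_bot_iff]
    intro w hw
    have : e.symm w ∈ N.comap e.toLinearMap := by simpa using hw
    rw [h, Submodule.mem_bot] at this
    simpa using this
  · right
    rw [eq_top_iff]
    intro w _
    have : e.symm w ∈ N.comap e.toLinearMap := h ▸ Submodule.mem_top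
    simpa using this

end

/-! ### Modules as multisets of irreducible classes -/

/-- The equivalence classes of irreducible representations of all dimensions. -/
abbrev IrrIndex : Type := Σ p : ℕ, irrClass p

/-- A representative of a class of irreducible representations. -/
noncomputable def IrrIndex.rep (s : IrrIndex) : Rep (Fin s.1 → ℂ) := s.2.2.choose

theorem IrrIndex.isIrreducible (s : IrrIndex) : IsIrreducible s.rep := s.2.2.choose_spec.1

theorem IrrIndex.mk_rep (s : IrrIndex) :
    (Quotient.mk (repSetoid s.1) s.rep : ModClass s.1) = s.2.1 := s.2.2.choose_spec.2

theorem IrrIndex.eq_of_equivalent {s t : IrrIndex} (h : Equivalent s.rep t.rep) : s = t := by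
  have hd : s.1 = t.1 := by
    obtain ⟨e, -⟩ := h
    simpa using e.finrank_eq
  have hs := s.mk_rep
  have ht := t.mk_rep
  obtain ⟨p, c⟩ := s
  obtain ⟨q, d⟩ := t
  obtain rfl : p = q := hd
  have : c = d := Subtype.ext (hs.symm.trans ((Quotient.sound h).trans ht))
  rw [this]

theorem IrrIndex.fst_pos (s : IrrIndex) : 0 < s.1 := by
  have := s.isIrreducible.1
  have := Module.finrank_pos (R := ℂ) (M := Fin s.1 → ℂ)
  simpa using this

/-- An irreducible representation is equivalent to the representative of its class. -/
theorem IsIrreducible.exists_index {V : Type} [AddCommGroup V] [Module ℂ V]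
    [FiniteDimensional ℂ V] {ρ : Rep V} (hρ : IsIrreducible ρ) :
    ∃ s : IrrIndex, Equivalent ρ s.rep := by
  have e : V ≃ₗ[ℂ] (Fin (finrank ℂ V) → ℂ) := LinearEquiv.ofFinrankEq _ _ (by simp)
  have h := Rep.equivalent_transport ρ e
  let s : IrrIndex := ⟨finrank ℂ V, Quotient.mk _ (ρ.transport e), _, hρ.congr h, rfl⟩
  exact ⟨s, h.trans (Quotient.exact s.mk_rep.symm)⟩

/-- The direct sum of the representatives of a family of classes. -/
noncomputable abbrev sumRep {ι : Type} (s : ι → IrrIndex) : Rep (∀ i, Fin (s i).1 → ℂ) :=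
  Rep.pi fun i => (s i).rep

-- By Schur each summand contributes 1 or 0. The multiset of summands can thus be read off from the
-- module, which gives uniqueness of the decomposition.
open Classical in
theorem finrank_intertwiners_sumRep {ι : Type} [Fintype ι] (s : ι → IrrIndex) (c : IrrIndex) :
    finrank ℂ (intertwiners c.rep (sumRep s)) = (Finset.univ.val.map s).count c := by
  rw [finrank_intertwiners_pi, Multiset.count_map, ← Finset.filter_val, Finset.card_val,
    Finset.card_filter]
  refine Finset.sum_congr rfl fun i _ => ?_
  split_ifs with h
  · subst h
    exact (s i).isIrreducible.finrank_intertwiners_of_equivalent (s i).isIrreducible (.refl _)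
  · exact c.isIrreducible.finrank_intertwiners_of_not_equivalent (s i).isIrreducible
      fun h' => h (IrrIndex.eq_of_equivalent h')

theorem equivalent_sumRep_of_map_eq {ι κ : Type} [Fintype ι] [Fintype κ] {s : ι → IrrIndex}
    {t : κ → IrrIndex} (h : Finset.univ.val.map s = Finset.univ.val.map t) :
    Equivalent (sumRep s) (sumRep t) := by
  classical
  have hc : ∀ c, Nonempty ({i // s i = c} ≃ {j // t j = c}) := by
    intro c
    have := congrArg (Multiset.count c) h
    rw [Multiset.count_map, Multiset.count_map, ← Finset.filter_val, ← Finset.filter_val,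
      Finset.card_val, Finset.card_val] at this
    refine ⟨Fintype.equivOfCardEq ?_⟩
    rw [Fintype.card_subtype, Fintype.card_subtype]
    simpa [eq_comm] using this
  let e : ι ≃ κ := Equiv.ofFiberEquiv fun c => (hc c).some
  have he : ∀ i, t (e i) = s i := Equiv.ofFiberEquiv_map _
  -- The construction of e refers to s; forgetting it allows s to be replaced by `t ∘ e`.
  clear_value e
  obtain rfl : s = t ∘ e := funext fun i => (he i).symm
  exact Equivalent.symm ⟨LinearEquiv.piCongrLeft' ℂ _ e.symm, fun _ _ => rfl⟩

theorem exists_equivalent_sumRep {V : Type} [AddCommGroup V] [Module ℂ V]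
    [FiniteDimensional ℂ V] (ρ : Rep V) :
    ∃ (ι : Type) (_ : Fintype ι) (s : ι → IrrIndex), Equivalent (sumRep s) ρ := by
  induction hn : finrank ℂ V using Nat.strong_induction_on generalizing V with
  | _ n ih =>
    by_cases hV : Nontrivial V
    · by_cases hρ : IsIrreducible ρ
      · obtain ⟨s, hs⟩ := hρ.exists_index
        exact ⟨Unit, inferInstance, fun _ => s, Equivalent.trans
          ⟨LinearEquiv.funUnique Unit ℂ _, fun _ _ => rfl⟩ hs.symm⟩
      · obtain ⟨W, hW, hbot, htop⟩ : ∃ W : Submodule ℂ V, (∀ (x : su3), ∀ v ∈ W, ρ x v ∈ W) ∧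
            W ≠ ⊥ ∧ W ≠ ⊤ := by
          unfold IsIrreducible at hρ
          push Not at hρ
          exact hρ hV
        obtain ⟨W', hW', hc⟩ := Rep.exists_isCompl ρ hW
        have hlt : finrank ℂ W < n := hn ▸ Submodule.finrank_lt htop
        have hlt' : finrank ℂ W' < n := by
          refine hn ▸ Submodule.finrank_lt fun h => hbot ?_
          simpa [h] using hc.inf_eq_bot
        obtain ⟨ι, _, s, e, he⟩ := ih _ hlt (ρ.restrict W hW) rfl
        obtain ⟨κ, _, t, f, hf⟩ := ih _ hlt' (ρ.restrict W' hW') rfl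
        refine ⟨ι ⊕ κ, inferInstance, Sum.elim s t,
          (LinearEquiv.sumPiEquivProdPi ℂ ι κ fun i => Fin (Sum.elim s t i).1 → ℂ).trans
            ((e.prodCongr f).trans (Submodule.prodEquivOfIsCompl W W' hc)), fun x v => ?_⟩
        have h1 := congrArg Subtype.val (he x fun i => v (Sum.inl i))
        have h2 := congrArg Subtype.val (hf x fun i => v (Sum.inr i))
        have h3 := congrArg₂ (· + ·) h1 h2
        refine h3.trans ?_
        exact (map_add (ρ x) _ _).symm
    · rw [not_nontrivial_iff_subsingleton] at hV
      -- The zero module is the empty direct sum.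
      exact ⟨Empty, inferInstance, Empty.elim, 0, fun _ _ => Subsingleton.elim _ _⟩

theorem finrank_sumRep {ι : Type} [Fintype ι] (s : ι → IrrIndex) :
    finrank ℂ (∀ i, Fin (s i).1 → ℂ) = ((Finset.univ.val.map s).map Sigma.fst).sum := by
  rw [Module.finrank_pi_fintype]
  simp

/-- The classes of `D`-dimensional representations correspond to the multisets of irreducible
classes with total dimension `D`. -/
theorem nonempty_equiv_modClass (D : ℕ) :
    Nonempty ({m : Multiset IrrIndex // (m.map Sigma.fst).sum = D} ≃ ModClass D) := by
  have key : ∀ m : {m : Multiset IrrIndex // (m.map Sigma.fst).sum = D},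
      ∃ (ρ : Rep (Fin D → ℂ)) (ι : Type) (_ : Fintype ι) (s : ι → IrrIndex),
        Finset.univ.val.map s = m.1 ∧ Equivalent (sumRep s) ρ := by
    rintro ⟨m, hm⟩
    have hs : Finset.univ.val.map m.toList.get = m := by
      rw [Fin.univ_val_map, List.ofFn_get, Multiset.coe_toList]
    have e : (∀ i, Fin (m.toList.get i).1 → ℂ) ≃ₗ[ℂ] (Fin D → ℂ) :=
      LinearEquiv.ofFinrankEq _ _ (by rw [finrank_sumRep, hs, hm, Module.finrank_fin_fun])
    exact ⟨_, _, inferInstance, m.toList.get, hs, Rep.equivalent_transport _ e⟩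
  choose ρ ι _ s hs hρ using key
  refine ⟨Equiv.ofBijective (fun m => (Quotient.mk (repSetoid D) (ρ m) : ModClass D)) ⟨?_, ?_⟩⟩
  · intro m m' h
    classical
    have h' : Equivalent (ρ m) (ρ m') := Quotient.exact h
    refine Subtype.ext (Multiset.ext.mpr fun c => ?_)
    rw [← hs, ← hs, ← finrank_intertwiners_sumRep, ← finrank_intertwiners_sumRep]
    exact finrank_intertwiners_congr _ ((hρ m).trans (h'.trans (hρ m').symm))
  · intro c
    induction c using Quotient.inductionOn with
    | h σ =>
      obtain ⟨κ, _, t, ht⟩ := exists_equivalent_sumRep σ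
      have hD : ((Finset.univ.val.map t).map Sigma.fst).sum = D := by
        obtain ⟨e, -⟩ := ht
        rw [← finrank_sumRep, e.finrank_eq, Module.finrank_fin_fun]
      refine ⟨⟨_, hD⟩, Quotient.sound (Equivalent.trans (hρ _).symm (Equivalent.trans ?_ ht))⟩
      exact equivalent_sumRep_of_map_eq (hs ⟨_, hD⟩)


/-! ### Multisets with prescribed first components -/

section Multiset

variable {α : Type} {T : α → Type}

theorem exists_eq_sum_map_sigma_mk [DecidableEq α] (m : Multiset (Σ a, T a)) (t : Finset α)
    (ht : ∀ x ∈ m, x.1 ∈ t) :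
    ∃ g : ∀ a, Multiset (T a), m = ∑ a ∈ t, (g a).map (Sigma.mk a) := by
  induction m using Multiset.induction_on with
  | empty => exact ⟨fun _ => 0, by simp⟩
  | cons x m ih =>
    obtain ⟨g, hg⟩ := ih fun y hy => ht y (Multiset.mem_cons_of_mem hy)
    refine ⟨g + Pi.single x.1 {x.2}, ?_⟩
    simp only [Pi.add_apply, Multiset.map_add, Finset.sum_add_distrib, ← hg]
    rw [Finset.sum_eq_single x.1, Pi.single_eq_same, Multiset.map_singleton, add_comm,
      Multiset.singleton_add]
    · intro b _ hb
      rw [Pi.single_eq_of_ne hb, Multiset.map_zero]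
    · exact fun h => absurd (ht x (Multiset.mem_cons_self x m)) h

theorem count_sum_map_sigma_mk [DecidableEq (Σ a, T a)] [∀ a, DecidableEq (T a)]
    (t : Finset α) (g : ∀ a, Multiset (T a)) {a : α} (ha : a ∈ t) (x : T a) :
    (∑ a ∈ t, (g a).map (Sigma.mk a)).count ⟨a, x⟩ = (g a).count x := by
  rw [Multiset.count_sum', Finset.sum_eq_single_of_mem a ha,
    Multiset.count_map_eq_count' _ _ sigma_mk_injective]
  intro b _ hb
  rw [Multiset.count_eq_zero]
  intro h
  obtain ⟨y, -, hy⟩ := Multiset.mem_map.mp h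
  exact hb (congrArg Sigma.fst hy)

theorem map_fst_sum_map_sigma_mk (t : Finset α) (g : ∀ a, Multiset (T a)) :
    (∑ a ∈ t, (g a).map (Sigma.mk a)).map Sigma.fst = ∑ a ∈ t, (g a).card • {a} := by
  rw [← Multiset.coe_mapAddMonoidHom, map_sum]
  refine Finset.sum_congr rfl fun a _ => ?_
  rw [Multiset.coe_mapAddMonoidHom, Multiset.map_map, Multiset.nsmul_singleton]
  exact Multiset.map_const' _ _

/-- A multiset of a sigma type with prescribed first components amounts to a choice, for each first
component, of a multiset of the right size. -/
theorem nonempty_equiv_sigma_multiset [DecidableEq α] (P : Multiset α) :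
    Nonempty ((∀ a : P.toFinset, Sym (T a) (P.count a.1)) ≃
      {m : Multiset (Σ a, T a) // m.map Sigma.fst = P}) := by
  classical
  -- The default 0 is harmless: all sums below run over `P.toFinset`.
  let ext : (∀ a : P.toFinset, Sym (T a) (P.count a.1)) → ∀ a, Multiset (T a) :=
    fun f a => if h : a ∈ P.toFinset then (f ⟨a, h⟩).1 else 0
  have hext : ∀ f, ∀ a : P.toFinset, ext f a = (f a).1 := fun f a => dif_pos a.2
  have hmap : ∀ f, (∑ a ∈ P.toFinset, (ext f a).map (Sigma.mk a)).map Sigma.fst = P := by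
    intro f
    rw [map_fst_sum_map_sigma_mk]
    conv_rhs => rw [← Multiset.toFinset_sum_count_nsmul_eq P]
    refine Finset.sum_congr rfl fun a ha => ?_
    rw [hext f ⟨a, ha⟩, (f ⟨a, ha⟩).2]
  refine ⟨Equiv.ofBijective (fun f => ⟨_, hmap f⟩) ⟨fun f f' h => ?_, ?_⟩⟩
  · funext a
    refine Subtype.ext (Multiset.ext.mpr fun x => ?_)
    have := congrArg (Multiset.count ⟨a.1, x⟩) (congrArg Subtype.val h)
    simp only [count_sum_map_sigma_mk _ _ a.2] at this
    rwa [hext, hext] at this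
  · rintro ⟨m, hm⟩
    obtain ⟨g, hg⟩ := exists_eq_sum_map_sigma_mk m P.toFinset fun x hx => by
      rw [Multiset.mem_toFinset, ← hm]
      exact Multiset.mem_map_of_mem _ hx
    have hP := map_fst_sum_map_sigma_mk P.toFinset g
    rw [← hg, hm] at hP
    have hcard : ∀ a : P.toFinset, (g a).card = P.count a.1 := by
      intro a
      have h := congrArg (Multiset.count a.1) hP
      rw [h, Multiset.count_sum', Finset.sum_eq_single_of_mem a.1 a.2]
      · simp
      · intro b _ hb
        simp [hb.symm]
    refine ⟨fun a => ⟨g a, hcard a⟩, Subtype.ext ?_⟩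
    refine Eq.trans (Finset.sum_congr rfl fun a ha => ?_) hg.symm
    exact congrArg (Multiset.map (Sigma.mk a)) (hext (fun a => ⟨g a, hcard a⟩) ⟨a, ha⟩)

end Multiset

theorem finite_sym {β : Type} [Finite β] (n : ℕ) : Finite (Sym β n) := by
  classical
  have := Fintype.ofFinite β
  infer_instance

/-- Multisets of irreducible classes with total dimension `D`, sorted by their dimensions. -/
noncomputable def multisetEquivSigma (D : ℕ) :
    {m : Multiset IrrIndex // (m.map Sigma.fst).sum = D} ≃
      Σ P : Nat.Partition D, {m : Multiset IrrIndex // m.map Sigma.fst = P.parts} where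
  toFun m := ⟨⟨m.1.map Sigma.fst, fun {i} hi => by
    obtain ⟨s, -, rfl⟩ := Multiset.mem_map.mp hi
    exact IrrIndex.fst_pos s, m.2⟩, m.1, rfl⟩
  invFun m := ⟨m.2.1, by rw [m.2.2, m.1.parts_sum]⟩
  left_inv _ := rfl
  right_inv := by
    rintro ⟨⟨P, h1, h2⟩, m, hm⟩
    change m.map Sigma.fst = P at hm
    subst hm
    rfl

end SuThree

/-! ### The count -/

theorem theorem1 (D : ℕ) :
    Finite (SuThree.ModClass D) ∧
    (∀ p : ℕ, (SuThree.irrClass p).Finite) ∧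
    SuThree.modCount D =
      ∑ P ∈ SuThree.partitionsIn SuThree.R3 D,
        ∏ p ∈ P.parts.toFinset,
          (P.parts.count p + SuThree.xi p - 1).choose (P.parts.count p) := by
  have hfin : ∀ p, Finite (SuThree.irrClass p) := fun p => SuThree.finite_irrClass p
  have hsym : ∀ p n, Finite (Sym (SuThree.irrClass p) n) := fun p n => SuThree.finite_sym n
  obtain ⟨e⟩ := SuThree.nonempty_equiv_modClass D
  let e' := e.symm.trans (SuThree.multisetEquivSigma D)
  have hsig := fun P : Nat.Partition D =>
    SuThree.nonempty_equiv_sigma_multiset (T := fun p => SuThree.irrClass p) P.parts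
  have hfib : ∀ P : Nat.Partition D,
      Finite {m : Multiset SuThree.IrrIndex // m.map Sigma.fst = P.parts} :=
    fun P => Finite.of_equiv _ (hsig P).some
  refine ⟨Finite.of_equiv _ e'.symm, fun p => SuThree.finite_irrClass p, ?_⟩
  rw [SuThree.modCount, Nat.card_congr e', Nat.card_sigma, SuThree.partitionsIn,
    Nat.Partition.restricted]
  have hcard : ∀ P : Nat.Partition D,
      Nat.card {m : Multiset SuThree.IrrIndex // m.map Sigma.fst = P.parts} =
        ∏ p ∈ P.parts.toFinset,
          (P.parts.count p + SuThree.xi p - 1).choose (P.parts.count p) := by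
    intro P
    rw [← Nat.card_congr (hsig P).some, Nat.card_pi, ← Finset.prod_coe_sort P.parts.toFinset]
    refine Finset.prod_congr rfl fun p _ => ?_
    rw [Sym.natCard_sym_eq_choose, Nat.card_coe_set_eq, add_comm, SuThree.xi]
  simp only [hcard]
  symm
  -- The sum over all partitions reduces to those with parts in R₃: a part p with ξ(p) = 0 and
  -- multiplicity n ≥ 1 contributes the factor `(n - 1).choose n = 0`.
  refine Finset.sum_subset (Finset.subset_univ _) fun P _ hP => ?_
  simp only [Finset.mem_filter, Finset.mem_univ, true_and, not_forall] at hP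
  obtain ⟨p, hp, hp'⟩ := hP
  have hxi : SuThree.xi p = 0 := not_not.mp hp'
  refine Finset.prod_eq_zero (Multiset.mem_toFinset.mpr hp) (Nat.choose_eq_zero_of_lt ?_)
  have := Multiset.count_pos.mpr hp
  omega
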